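/- There are absolute constants $c, C > 0$ such that the following holds. Let $G$ be a finite abelian group, let $A, B \subseteq G$ be non-empty, and let $K_A, K_B$ be real numbers with $|A+B| \le K_A|A|$ and $|A+B| \le K_B|B|$. Let $p \ge 2$ be real and let $0 < \epsilon \le 1/\sqrt{K_B}$. Then there are a non-empty set $\Gamma$ of characters $\gamma : G \to \mathbb{C}^\times$, of size $d = |\Gamma|$ (so $d \ge 1$) with $$d \le \frac{C\,p\,\big(\log (2K_A/\epsilon)\big)^2 \log (2K_A)}{\epsilon^2} + C\log\big(\mu_G(B)^{-1}\big),$$ and a real number $\delta \ge \dfrac{c\,\epsilon}{d\sqrt{K_A}}$ such that every element $t$ of the Bohr set $$T = \{x \in G : |\gamma(x) - 1| \le \delta \text{ for all } \gamma \in \Gamma\}$$ (of rank $d$ and radius $\delta$) satisfies $$\big\| \mu_A * 1_B(\cdot + t) - \mu_A * 1_B \big\|_{p} \le \epsilon\, \|\mu_A * 1_B\|_{p/2}^{1/2}.$$ Here $\mu_G(X) = |X|/|G|$, $\mu_A = 1_A/\mu_G(A)$, $f*g(x) = |G|^{-1}\sum_{y\in G} f(y)g(x-y)$ and $\|f\|_q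 = \big(|G|^{-1}\sum_{x \in G}|f(x)|^q\big)^{1/q}$. -/

import Mathlib

open scoped BigOperators Pointwise

namespace AlmostPeriodicity

/-- The Bohr set `{x ∈ G : |γ(x) - 1| ≤ δ for all γ ∈ Γ}` of the frequency set `Γ ⊆ Ĝ` and the
radius `δ`. Its rank is `Γ.card`. -/
def bohrSet {G : Type*} [AddCommGroup G] (Γ : Finset (AddChar G ℂ)) (δ : ℝ) : Set G :=
  {x | ∀ γ ∈ Γ, ‖γ x - 1‖ ≤ δ}

/-- The indicator function `1_A` of a subset `A` of `G`. -/
noncomputable def ind {G : Type*} (A : Finset G) : G → ℂ :=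
  Set.indicator (A : Set G) 1

/-- `μ_A = 1_A / μ_G(A)`, where `μ_G(A) = |A| / |G|` is the density of `A`. -/
noncomputable def normInd {G : Type*} [Fintype G] (A : Finset G) : G → ℂ :=
  fun x => ind A x / (A.dens : ℂ)

/-- The normalized convolution `f * g (x) = 𝔼_y f(y) g(x - y)`. -/
noncomputable def convolution {G : Type*} [AddCommGroup G] [Fintype G] (f g : G → ℂ) : G → ℂ :=
  fun x => 𝔼 y, f y * g (x - y)

/-- The normalized norm `‖f‖_p = (𝔼_x |f(x)|^p)^(1/p)`, used for real exponents `p ≥ 1`. -/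
noncomputable def normLp {G : Type*} [Fintype G] (p : ℝ) (f : G → ℂ) : ℝ :=
  (𝔼 x, ‖f x‖ ^ p) ^ (1 / p)

end AlmostPeriodicity

open scoped ComplexConjugate

namespace AlmostPeriodicity

/-! ### Normalized `L^p` norms -/

section NormLp

variable {G : Type*} [Fintype G] {p : ℝ}

/-! Write f for μ_A * 1_B, so that f(x) is the probability that x - a ∈ B for random a ∈ A. The
proof combines Croot–Sisask sampling with Chang's theorem.

Sampling: let k be of order log(2K_A/ε), θ of order ε/k and n of order p/θ². For most a ∈ Aⁿ the
empirical average of 1_B(x - a_i) is within O(θ)‖f‖_{p/2}^{1/2} of f in `L^p`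
(`expect_empirical_sub_rpow_le`). Since A + B is small, a pigeonhole argument gives one tuple u for
which u - t is good for all t in a set T ⊆ B with |T| ≥ |B|/(2K_Aⁿ). Every t - t' with t, t' ∈ T is
then an almost-period of f.

Bootstrapping: convolve f k times with μ_T * μ_{-T} to get g, which is within ε/4 of f in the
relevant norm. Its Fourier coefficients are those of f times |\hat μ_T|^{2k}, hence negligible where
|\hat μ_T| ≤ 1/2. The remaining characters are controlled by O(log(1/μ_G(T))) of them
(`exists_forall_mem_bohrSet_norm_sub_one_le`), and their Bohr set consists of almost-periods of g,
hence of f.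

Both error estimates are measured against ‖f‖_{p/2} through the lower bound
`dens_mul_rpow_le_expect_proportion_rpow`. -/

lemma normLp_nonneg (p : ℝ) (f : G → ℂ) : 0 ≤ normLp p f :=
  Real.rpow_nonneg (Finset.expect_nonneg fun _ _ => by positivity) _

lemma normLp_rpow (hp : 1 ≤ p) (f : G → ℂ) : normLp p f ^ p = 𝔼 x, ‖f x‖ ^ p := by
  have h : 0 ≤ 𝔼 x, ‖f x‖ ^ p := Finset.expect_nonneg fun _ _ => by positivity
  rw [normLp, ← Real.rpow_mul h, one_div_mul_cancel (by linarith), Real.rpow_one]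

lemma normLp_le_iff (hp : 1 ≤ p) (f : G → ℂ) {c : ℝ} (hc : 0 ≤ c) :
    normLp p f ≤ c ↔ 𝔼 x, ‖f x‖ ^ p ≤ c ^ p := by
  rw [← normLp_rpow hp, Real.rpow_le_rpow_iff (normLp_nonneg _ _) hc (by linarith)]

lemma normLp_add_le (hp : 1 ≤ p) (f g : G → ℂ) :
    normLp p (fun x => f x + g x) ≤ normLp p f + normLp p g := by
  have hp0 : 0 ≤ p := by linarith
  have key := Real.Lp_add_le_of_nonneg Finset.univ (f := fun x => ‖f x‖) (g := fun x => ‖g x‖) hp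
    (fun _ _ => norm_nonneg _) (fun _ _ => norm_nonneg _)
  have hmono : (∑ x, ‖f x + g x‖ ^ p) ^ (1 / p) ≤ (∑ x, (‖f x‖ + ‖g x‖) ^ p) ^ (1 / p) := by
    gcongr
    exact norm_add_le _ _
  simp only [normLp, Fintype.expect_eq_sum_div_card]
  rw [Real.div_rpow, Real.div_rpow, Real.div_rpow, ← add_div]
  · gcongr
    exact hmono.trans key
  all_goals positivity

lemma normLp_sub_comm (p : ℝ) (f g : G → ℂ) :
    normLp p (fun x => f x - g x) = normLp p (fun x => g x - f x) := by
  simp only [normLp, norm_sub_rev]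

lemma normLp_sub_le (hp : 1 ≤ p) (f g h : G → ℂ) :
    normLp p (fun x => f x - h x) ≤
      normLp p (fun x => f x - g x) + normLp p (fun x => g x - h x) := by
  simpa using normLp_add_le hp (fun x => f x - g x) (fun x => g x - h x)

lemma normLp_translate [AddCommGroup G] (p : ℝ) (f : G → ℂ) (t : G) :
    normLp p (fun x => f (x + t)) = normLp p f := by
  simp only [normLp]
  congr 1
  exact Fintype.expect_equiv (Equiv.addRight t) _ _ fun _ => rfl

/-- Convexity of y ↦ y^p, applied pointwise, followed by exchanging the two averages. -/
lemma normLp_expect_le (hp : 1 ≤ p) {ι : Type*} (s : Finset ι) (hs : s.Nonempty) (f : ι → G → ℂ)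
    {c : ℝ} (hc : 0 ≤ c) (h : ∀ i ∈ s, normLp p (f i) ≤ c) :
    normLp p (fun x => 𝔼 i ∈ s, f i x) ≤ c := by
  have hs0 : (0 : ℝ) < s.card := by exact_mod_cast hs.card_pos
  rw [normLp_le_iff hp _ hc]
  have hpt : ∀ x, ‖𝔼 i ∈ s, f i x‖ ^ p ≤ 𝔼 i ∈ s, ‖f i x‖ ^ p := by
    intro x
    have h1 : ‖𝔼 i ∈ s, f i x‖ ≤ 𝔼 i ∈ s, ‖f i x‖ := by
      rw [Finset.expect_eq_sum_div_card, Finset.expect_eq_sum_div_card, norm_div,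
        Complex.norm_natCast]
      gcongr
      exact norm_sum_le _ _
    have h2 := Real.rpow_arith_mean_le_arith_mean_rpow s (fun _ => (s.card : ℝ)⁻¹)
      (fun i => ‖f i x‖) (fun _ _ => by positivity)
      (by rw [Finset.sum_const, nsmul_eq_mul, mul_inv_cancel₀ hs0.ne'])
      (fun _ _ => norm_nonneg _) hp
    rw [← Finset.mul_sum, ← Finset.mul_sum, inv_mul_eq_div, inv_mul_eq_div,
      ← Finset.expect_eq_sum_div_card, ← Finset.expect_eq_sum_div_card] at h2
    exact (Real.rpow_le_rpow (norm_nonneg _) h1 (by linarith)).trans h2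
  calc 𝔼 x, ‖𝔼 i ∈ s, f i x‖ ^ p ≤ 𝔼 x, 𝔼 i ∈ s, ‖f i x‖ ^ p :=
        Finset.expect_le_expect fun x _ => hpt x
    _ = 𝔼 i ∈ s, 𝔼 x, ‖f i x‖ ^ p := Finset.expect_comm _ _ _
    _ ≤ c ^ p := Finset.expect_le hs fun i hi => (normLp_le_iff hp _ hc).1 (h i hi)

end NormLp

/-! ### Moments of a binomial variable -/

section Moments

/-- Raise y/p ≤ exp(y/p) to the power p. This converts exponential moments into p-th moments. -/
lemma rpow_le_rpow_mul_exp {p y : ℝ} (hp : 0 < p) (hy : 0 ≤ y) : y ^ p ≤ p ^ p * Real.exp y := by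
  have h : y / p ≤ Real.exp (y / p) := by linarith [Real.add_one_le_exp (y / p)]
  have h' : y ≤ p * Real.exp (y / p) := by
    rwa [div_le_iff₀ hp, mul_comm] at h
  calc y ^ p ≤ (p * Real.exp (y / p)) ^ p := Real.rpow_le_rpow hy h' hp.le
    _ = p ^ p * Real.exp y := by
      rw [Real.mul_rpow hp.le (Real.exp_pos _).le, ← Real.exp_mul, div_mul_cancel₀ _ hp.ne']

variable {α : Type*} [DecidableEq α] (A D : Finset α) (n : ℕ)

/-- The number of coordinates of `a` that lie in `D`. -/
def hits {α : Type*} [DecidableEq α] (D : Finset α) {n : ℕ} (a : Fin n → α) : ℕ :=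
  ∑ i, if a i ∈ D then 1 else 0

/-- The coordinates are independent and uniform on A, so `hits D` is binomial and its moment
generating function factorizes. -/
lemma expect_exp_hits (hA : A.Nonempty) (t : ℝ) :
    𝔼 a ∈ Fintype.piFinset (fun _ : Fin n => A), Real.exp (t * hits D a) =
      (1 + ((A ∩ D).card / A.card : ℝ) * (Real.exp t - 1)) ^ n := by
  have hA0 : (0 : ℝ) < A.card := by exact_mod_cast hA.card_pos
  have h1 : ∀ a : Fin n → α, Real.exp (t * hits D a) =
      ∏ i, (1 + (if a i ∈ D then 1 else 0) * (Real.exp t - 1)) := by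
    intro a
    rw [hits, Nat.cast_sum, Finset.mul_sum, Real.exp_sum]
    refine Finset.prod_congr rfl fun i _ => ?_
    split_ifs <;> simp
  rw [Finset.expect_eq_sum_div_card]
  simp only [h1]
  rw [← Finset.prod_univ_sum (fun _ : Fin n => A)
    (fun _ j => 1 + (if j ∈ D then (1 : ℝ) else 0) * (Real.exp t - 1)), Fintype.card_piFinset]
  simp only [Finset.prod_const, Finset.card_univ, Fintype.card_fin, Nat.cast_pow]
  rw [← div_pow]
  congr 1
  rw [Finset.sum_add_distrib, ← Finset.sum_mul, Finset.sum_ite_mem]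
  simp
  field_simp

variable {A D n}

lemma expect_exp_hits_le (hA : A.Nonempty) {t : ℝ} (ht : |t| ≤ 1) {q : ℝ}
    (hq : q = ((A ∩ D).card / A.card : ℝ)) :
    𝔼 a ∈ Fintype.piFinset (fun _ : Fin n => A), Real.exp (t * (hits D a - n * q)) ≤
      Real.exp (n * q * t ^ 2) := by
  have hq0 : 0 ≤ q := by rw [hq]; positivity
  have h1 : ∀ a : Fin n → α, Real.exp (t * (hits D a - n * q)) =
      Real.exp (t * hits D a) * Real.exp (-(t * (n * q))) := by
    intro a; rw [← Real.exp_add]; congr 1; ring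
  simp only [h1]
  rw [← Finset.expect_mul, expect_exp_hits A D n hA, ← hq]
  have h2 : 1 + q * (Real.exp t - 1) ≤ Real.exp (q * (t + t ^ 2)) := by
    have h3 := (abs_le.1 (Real.abs_exp_sub_one_sub_id_le ht)).2
    have h4 := Real.add_one_le_exp (q * (t + t ^ 2))
    nlinarith
  have h5 : 0 ≤ 1 + q * (Real.exp t - 1) := by
    have hq1 : q ≤ 1 := by
      rw [hq]
      refine div_le_one_of_le₀ ?_ (by positivity)
      exact_mod_cast Finset.card_le_card Finset.inter_subset_left
    nlinarith [Real.exp_pos t]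
  calc (1 + q * (Real.exp t - 1)) ^ n * Real.exp (-(t * (n * q)))
      ≤ Real.exp (q * (t + t ^ 2)) ^ n * Real.exp (-(t * (n * q))) := by gcongr
    _ = Real.exp (n * q * t ^ 2) := by
      rw [← Real.exp_nat_mul, ← Real.exp_add]; congr 1; ring

/-- The Gaussian regime: t = √(p/(nq)) is at most 1 and makes the exponent n q t² equal to p, while
p/t = √(p n q) is the expected size of the deviation. -/
lemma expect_abs_hits_sub_rpow_le_of_le (hA : A.Nonempty) {p q : ℝ} (hp : 2 ≤ p)
    (hq : q = ((A ∩ D).card / A.card : ℝ)) (hpq : p ≤ n * q) :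
    𝔼 a ∈ Fintype.piFinset (fun _ : Fin n => A), |(hits D a : ℝ) - n * q| ^ p ≤
      20 ^ p * (p * (n * q)) ^ (p / 2) := by
  have hp0 : 0 < p := by linarith
  have hnq : 0 < n * q := by linarith
  set t := Real.sqrt (p / (n * q)) with ht
  have ht0 : 0 < t := Real.sqrt_pos.2 (by positivity)
  have ht1 : t ≤ 1 := Real.sqrt_le_one.2 (div_le_one_of_le₀ hpq hnq.le)
  have ht2 : n * q * t ^ 2 = p := by
    rw [ht, Real.sq_sqrt (by positivity), mul_div_cancel₀ _ hnq.ne']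
  have hpt : ∀ x : ℝ, |x| ^ p ≤
      (p / t) ^ p * (Real.exp (t * x) + Real.exp (-t * x)) := by
    intro x
    have h1 := rpow_le_rpow_mul_exp hp0 (y := t * |x|) (by positivity)
    rw [Real.mul_rpow ht0.le (abs_nonneg x)] at h1
    have h2 : Real.exp (t * |x|) ≤ Real.exp (t * x) + Real.exp (-t * x) := by
      rcases abs_cases x with h | h <;> rw [h.1]
      · linarith [Real.exp_pos (-t * x)]
      · rw [mul_neg, ← neg_mul]; linarith [Real.exp_pos (t * x)]
    rw [Real.div_rpow hp0.le ht0.le, div_mul_eq_mul_div, le_div_iff₀ (by positivity), mul_comm]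
    exact h1.trans (by gcongr)
  have e1 := expect_exp_hits_le (D := D) (n := n) hA (t := t) (by rwa [abs_of_pos ht0]) hq
  have e2 := expect_exp_hits_le (D := D) (n := n) hA (t := -t)
    (by rwa [abs_neg, abs_of_pos ht0]) hq
  rw [neg_sq] at e2
  rw [ht2] at e1 e2
  have hroot : (p / t) ^ p = (p * (n * q)) ^ (p / 2) := by
    have h3 : p / t = Real.sqrt (p * (n * q)) := by
      rw [eq_comm, Real.sqrt_eq_iff_mul_self_eq (by positivity) (by positivity)]
      rw [div_mul_div_comm, eq_div_iff (by positivity), ← pow_two t, mul_assoc, ht2]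
    rw [h3, Real.sqrt_eq_rpow, ← Real.rpow_mul (by positivity)]
    congr 1; ring
  calc 𝔼 a ∈ Fintype.piFinset (fun _ : Fin n => A), |(hits D a : ℝ) - n * q| ^ p
      ≤ 𝔼 a ∈ Fintype.piFinset (fun _ : Fin n => A), (p / t) ^ p *
          (Real.exp (t * (hits D a - n * q)) + Real.exp (-t * (hits D a - n * q))) :=
        Finset.expect_le_expect fun a _ => hpt _
    _ ≤ (p / t) ^ p * (Real.exp p + Real.exp p) := by
        rw [← Finset.mul_expect, Finset.expect_add_distrib]
        gcongr
    _ = 2 * Real.exp p * (p * (n * q)) ^ (p / 2) := by rw [hroot]; ring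
    _ ≤ 20 ^ p * (p * (n * q)) ^ (p / 2) := by
        gcongr
        have h4 : (2 : ℝ) ≤ 2 ^ p := by
          simpa using Real.rpow_le_rpow_of_exponent_le (x := 2) (by norm_num)
            (show (1 : ℝ) ≤ p by linarith)
        have h5 : Real.exp p ≤ 3 ^ p := by
          rw [← Real.exp_one_rpow]
          exact Real.rpow_le_rpow (Real.exp_pos _).le (by linarith [Real.exp_one_lt_d9]) hp0.le
        calc 2 * Real.exp p ≤ 2 ^ p * 3 ^ p := by gcongr
          _ = 6 ^ p := by rw [← Real.mul_rpow] <;> norm_num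
          _ ≤ 20 ^ p := by gcongr; norm_num

/-- The Poisson regime, with the exponential moment at t = 1. The bound has to stay linear in nq,
because q will be averaged over x; hence the use of exp(m) - 1, which vanishes at m = 0. -/
lemma expect_abs_hits_sub_rpow_le_of_ge (hA : A.Nonempty) {p q : ℝ} (hp : 2 ≤ p)
    (hq : q = ((A ∩ D).card / A.card : ℝ)) (hpq : n * q ≤ p) :
    𝔼 a ∈ Fintype.piFinset (fun _ : Fin n => A), |(hits D a : ℝ) - n * q| ^ p ≤
      20 ^ p * (p ^ p * (n * q)) := by
  have hp0 : 0 < p := by linarith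
  have hq0 : 0 ≤ q := by rw [hq]; positivity
  have hnq : 0 ≤ n * q := by positivity
  have hpt : ∀ m : ℕ, |(m : ℝ) - n * q| ^ p ≤
      2 * p ^ p * (Real.exp m - 1) + p ^ p * (n * q) := by
    intro m
    -- Integrality of m is essential: either m = 0, or m ≥ 1 and exp(m) ≤ 2(exp(m) - 1).
    have h1 : (m : ℝ) ^ p ≤ 2 * p ^ p * (Real.exp m - 1) := by
      rcases Nat.eq_zero_or_pos m with rfl | hm
      · simp [Real.zero_rpow hp0.ne']
      · have hm1 : (1 : ℝ) ≤ m := by exact_mod_cast hm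
        have h2 := rpow_le_rpow_mul_exp hp0 (y := m) (by positivity)
        have h3 : Real.exp m ≤ 2 * (Real.exp m - 1) := by
          linarith [Real.add_one_le_exp (m : ℝ)]
        calc (m : ℝ) ^ p ≤ p ^ p * Real.exp m := h2
          _ ≤ p ^ p * (2 * (Real.exp m - 1)) := by gcongr
          _ = _ := by ring
    have h2 : (n * q) ^ p ≤ p ^ p * (n * q) := by
      rcases hnq.eq_or_lt with h | h
      · rw [← h]; simp [Real.zero_rpow hp0.ne']
      · calc (n * q) ^ p = (n * q) ^ (p - 1) * (n * q) := by
              rw [Real.rpow_sub_one h.ne', div_mul_cancel₀ _ h.ne']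
          _ ≤ p ^ (p - 1) * (n * q) := by
              gcongr
              linarith
          _ ≤ p ^ p * (n * q) := by
              gcongr
              · linarith
              · linarith
    have h3 : |(m : ℝ) - n * q| ≤ max (m : ℝ) (n * q) := by
      have hm : (0 : ℝ) ≤ m := m.cast_nonneg
      exact abs_le.2 ⟨by linarith [le_max_right (m : ℝ) (n * q)],
        by linarith [le_max_left (m : ℝ) (n * q)]⟩
    calc |(m : ℝ) - n * q| ^ p ≤ (max (m : ℝ) (n * q)) ^ p := by gcongr
      _ ≤ (m : ℝ) ^ p + (n * q) ^ p := by
        rcases max_cases (m : ℝ) (n * q) with h | h <;> rw [h.1]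
        · have : 0 ≤ (n * q) ^ p := by positivity
          linarith
        · have : 0 ≤ (m : ℝ) ^ p := by positivity
          linarith
      _ ≤ _ := add_le_add h1 h2
  have hne : (Fintype.piFinset (fun _ : Fin n => A)).Nonempty :=
    Fintype.piFinset_nonempty.2 fun _ => hA
  have e1 : 𝔼 a ∈ Fintype.piFinset (fun _ : Fin n => A), Real.exp (hits D a) ≤
      Real.exp (2 * (n * q)) := by
    have := expect_exp_hits A D n hA 1
    simp only [one_mul] at this
    rw [this, ← hq]
    have h2 : 1 + q * (Real.exp 1 - 1) ≤ Real.exp (2 * q) := by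
      have := Real.add_one_le_exp (2 * q)
      nlinarith [Real.exp_one_lt_d9]
    calc (1 + q * (Real.exp 1 - 1)) ^ n ≤ Real.exp (2 * q) ^ n := by
          gcongr
          nlinarith [Real.add_one_le_exp (1 : ℝ)]
      _ = Real.exp (2 * (n * q)) := by rw [← Real.exp_nat_mul]; congr 1; ring
  have e2 : Real.exp (2 * (n * q)) - 1 ≤ 2 * (n * q) * Real.exp (2 * p) := by
    have h1 := Real.add_one_le_exp (-(2 * (n * q)))
    have h2 : Real.exp (2 * (n * q)) * Real.exp (-(2 * (n * q))) = 1 := by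
      rw [← Real.exp_add]; simp
    have h3 : Real.exp (2 * (n * q)) - 1 ≤ 2 * (n * q) * Real.exp (2 * (n * q)) := by
      nlinarith [Real.exp_pos (2 * (n * q))]
    refine h3.trans ?_
    gcongr
  calc 𝔼 a ∈ Fintype.piFinset (fun _ : Fin n => A), |(hits D a : ℝ) - n * q| ^ p
      ≤ 𝔼 a ∈ Fintype.piFinset (fun _ : Fin n => A),
          (2 * p ^ p * (Real.exp (hits D a) - 1) + p ^ p * (n * q)) :=
        Finset.expect_le_expect fun a _ => hpt _
    _ = 2 * p ^ p * (𝔼 a ∈ Fintype.piFinset (fun _ : Fin n => A), Real.exp (hits D a) - 1)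
          + p ^ p * (n * q) := by
        rw [Finset.expect_add_distrib, ← Finset.mul_expect, Finset.expect_sub_distrib,
          Finset.expect_const hne, Finset.expect_const hne]
    _ ≤ 2 * p ^ p * (2 * (n * q) * Real.exp (2 * p)) + p ^ p * (n * q) := by
        gcongr
        linarith
    _ = (4 * Real.exp (2 * p) + 1) * (p ^ p * (n * q)) := by ring
    _ ≤ 20 ^ p * (p ^ p * (n * q)) := by
        gcongr
        have h4 : (4 : ℝ) ≤ 2 ^ p := by
          have := Real.rpow_le_rpow_of_exponent_le (x := 2) (by norm_num) hp
          norm_num at this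
          exact this
        have h5 : Real.exp (2 * p) ≤ 9 ^ p := by
          rw [Real.exp_mul]
          refine Real.rpow_le_rpow (Real.exp_pos _).le ?_ hp0.le
          have : Real.exp 2 = Real.exp 1 * Real.exp 1 := by rw [← Real.exp_add]; norm_num
          rw [this]
          nlinarith [Real.exp_one_lt_d9, Real.exp_pos 1]
        have h6 : (18 : ℝ) ^ p + 1 ≤ 20 ^ p := by
          have h7 := Real.add_rpow_le_rpow_add (a := 18) (b := 1) (p := p) (by norm_num)
            (by norm_num) (by linarith)
          rw [Real.one_rpow] at h7
          exact h7.trans (Real.rpow_le_rpow (by norm_num) (by norm_num) hp0.le)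
        calc 4 * Real.exp (2 * p) + 1 ≤ 2 ^ p * 9 ^ p + 1 := by gcongr
          _ = 18 ^ p + 1 := by rw [← Real.mul_rpow] <;> norm_num
          _ ≤ 20 ^ p := h6

lemma expect_abs_hits_sub_rpow_le (hA : A.Nonempty) {p q : ℝ} (hp : 2 ≤ p)
    (hq : q = ((A ∩ D).card / A.card : ℝ)) :
    𝔼 a ∈ Fintype.piFinset (fun _ : Fin n => A), |(hits D a : ℝ) - n * q| ^ p ≤
      20 ^ p * ((p * (n * q)) ^ (p / 2) + p ^ p * (n * q)) := by
  have hq0 : 0 ≤ q := by rw [hq]; positivity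
  rcases le_total p (n * q) with h | h
  · refine (expect_abs_hits_sub_rpow_le_of_le hA hp hq h).trans ?_
    gcongr
    have : 0 ≤ p ^ p * (n * q) := by positivity
    linarith
  · refine (expect_abs_hits_sub_rpow_le_of_ge hA hp hq h).trans ?_
    gcongr
    have : 0 ≤ (p * (n * q)) ^ (p / 2) := by positivity
    linarith

end Moments

/-! ### Croot–Sisask sampling -/

section Sampling

variable {G : Type*} [AddCommGroup G] [Fintype G] [DecidableEq G]

/-- The reflected translate `x - B`. -/
def reflect (B : Finset G) (x : G) : Finset G := Finset.univ.filter fun a => x - a ∈ B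

@[simp] lemma mem_reflect {B : Finset G} {x a : G} : a ∈ reflect B x ↔ x - a ∈ B := by
  simp [reflect]

/-- The proportion of `a ∈ A` for which `x - a ∈ B`, that is, the value of `μ_A * 1_B` at `x`. -/
noncomputable def proportion (A B : Finset G) (x : G) : ℝ :=
  ((A ∩ reflect B x).card / A.card : ℝ)

variable {A B : Finset G}

lemma card_reflect (B : Finset G) (x : G) : (reflect B x).card = B.card :=
  Finset.card_bij (fun a _ => x - a) (fun a ha => mem_reflect.1 ha)
    (fun a _ b _ h => sub_right_injective h)
    (fun b hb => ⟨x - b, by simpa using hb, by simp⟩)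

lemma convolution_normInd_ind (A B : Finset G) (x : G) :
    convolution (normInd A) (ind B) x = (proportion A B x : ℂ) := by
  have hG : (Fintype.card G : ℂ) ≠ 0 := by exact_mod_cast Fintype.card_ne_zero
  have h : ∀ y, normInd A y * ind B (x - y) =
      (if y ∈ A ∩ reflect B x then (1 : ℂ) else 0) / (A.dens : ℂ) := by
    intro y
    by_cases h1 : y ∈ A <;> by_cases h2 : x - y ∈ B <;> simp [normInd, ind, h1, h2]
  rw [convolution, Fintype.expect_eq_sum_div_card]
  simp only [h]
  rw [← Finset.sum_div, Finset.sum_ite_mem, Finset.univ_inter, Finset.sum_const, proportion,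
    Finset.dens]
  push_cast
  rcases eq_or_ne (A.card : ℂ) 0 with h0 | h0
  · simp [h0]
  · simp only [nsmul_eq_mul, mul_one]
    field_simp

lemma proportion_nonneg (A B : Finset G) (x : G) : 0 ≤ proportion A B x := by
  rw [proportion]; positivity

lemma proportion_le (A B : Finset G) (x : G) :
    proportion A B x ≤ B.card / A.card := by
  rw [proportion, ← card_reflect B x]
  gcongr
  exact Finset.inter_subset_right

lemma sum_proportion (hA : A.Nonempty) (B : Finset G) : ∑ x, proportion A B x = B.card := by
  have hA0 : (A.card : ℝ) ≠ 0 := by exact_mod_cast hA.card_pos.ne'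
  simp only [proportion]
  rw [← Finset.sum_div, div_eq_iff hA0]
  have h : ∀ x, ((A ∩ reflect B x).card : ℝ) = ∑ a ∈ A, if x - a ∈ B then 1 else 0 := by
    intro x
    rw [Finset.sum_boole, Finset.inter_comm, ← Finset.filter_mem_eq_inter]
    congr 2
    ext a; simp [and_comm]
  simp only [h]
  rw [Finset.sum_comm]
  have h2 : ∀ a ∈ A, (∑ x : G, if x - a ∈ B then (1 : ℝ) else 0) = B.card := by
    intro a _
    refine (Fintype.sum_equiv (Equiv.subRight a) _ (fun y => if y ∈ B then (1 : ℝ) else 0)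
      fun x => rfl).trans ?_
    simp
  rw [Finset.sum_congr rfl h2]
  simp [mul_comm]

lemma proportion_eq_zero {x : G} (hx : x ∉ A + B) : proportion A B x = 0 := by
  have : A ∩ reflect B x = ∅ := by
    refine Finset.eq_empty_of_forall_notMem fun a ha => hx ?_
    rw [Finset.mem_inter, mem_reflect] at ha
    exact Finset.mem_add.2 ⟨a, ha.1, x - a, ha.2, by abel⟩
  simp [proportion, this]

/-- The power mean inequality on A + B, which supports μ_A * 1_B and carries its total mass |B|. -/
lemma dens_mul_rpow_le_expect_proportion_rpow (hA : A.Nonempty) (hB : B.Nonempty) {s : ℝ}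
    (hs : 1 ≤ s) :
    (B.dens : ℝ) * ((B.card : ℝ) / (A + B).card) ^ (s - 1) ≤ 𝔼 x, proportion A B x ^ s := by
  have hB0 : (0 : ℝ) < B.card := by exact_mod_cast hB.card_pos
  have hAB0 : (0 : ℝ) < (A + B).card := by exact_mod_cast (hA.add hB).card_pos
  have h1 := Real.rpow_sum_le_const_mul_sum_rpow_of_nonneg (A + B) (f := proportion A B) hs
    (fun x _ => proportion_nonneg A B x)
  have h2 : ∑ x ∈ A + B, proportion A B x = B.card := by
    rw [← sum_proportion hA B]
    exact Finset.sum_subset (Finset.subset_univ _) fun x _ hx => proportion_eq_zero hx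
  have h3 : ∑ x ∈ A + B, proportion A B x ^ s ≤ ∑ x, proportion A B x ^ s :=
    Finset.sum_le_sum_of_subset_of_nonneg (Finset.subset_univ _)
      fun x _ _ => Real.rpow_nonneg (proportion_nonneg A B x) _
  rw [h2] at h1
  rw [Fintype.expect_eq_sum_div_card, Finset.dens, NNRat.cast_div, NNRat.cast_natCast,
    NNRat.cast_natCast, div_mul_eq_mul_div]
  gcongr
  refine le_trans ?_ h3
  rw [Real.div_rpow hB0.le hAB0.le, mul_div_assoc', div_le_iff₀ (by positivity), mul_comm,
    ← Real.rpow_add_one hB0.ne', sub_add_cancel, mul_comm]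
  exact h1

lemma expect_proportion_rpow_pos (hA : A.Nonempty) (hB : B.Nonempty) {s : ℝ} (hs : 1 ≤ s) :
    0 < 𝔼 x, proportion A B x ^ s := by
  refine lt_of_lt_of_le ?_ (dens_mul_rpow_le_expect_proportion_rpow hA hB hs)
  have hB0 : (0 : ℝ) < B.card := by exact_mod_cast hB.card_pos
  have hAB0 : (0 : ℝ) < (A + B).card := by exact_mod_cast (hA.add hB).card_pos
  have : (0 : ℝ) < B.dens := by exact_mod_cast hB.dens_pos
  positivity

lemma expect_proportion (hA : A.Nonempty) (B : Finset G) : 𝔼 x, proportion A B x = B.dens := by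
  rw [Fintype.expect_eq_sum_div_card, sum_proportion hA, Finset.dens]
  push_cast
  rfl

/-- The empirical average `n⁻¹ ∑ᵢ 1_B(x - aᵢ)`. -/
noncomputable def empirical (B : Finset G) {n : ℕ} (a : Fin n → G) (x : G) : ℝ :=
  hits (reflect B x) a / n

/-- Shifting the sample translates the empirical average; this turns good samples into
almost-periods. -/
lemma empirical_sub (B : Finset G) {n : ℕ} (u : Fin n → G) (t x : G) :
    empirical B (fun i => u i - t) x = empirical B u (x + t) := by
  simp only [empirical, hits, mem_reflect]
  congr 3
  funext i
  rw [show x - (u i - t) = x + t - u i by abel]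

/-- Apply the binomial moment bound with D = x - B and average over x. As p/n ≤ θ², the Gaussian
term yields θ^p M; the Poisson term is linear in `proportion A B x`, so it averages to a multiple of
the density of B. -/
lemma expect_empirical_sub_rpow_le (hA : A.Nonempty) (hB : B.Nonempty) {p θ : ℝ} (hp : 2 ≤ p)
    (hθ : 0 < θ) (hθB : θ ^ 2 ≤ (B.card : ℝ) / (A + B).card) {n : ℕ} (hn : p / θ ^ 2 ≤ n)
    (hn' : (n : ℝ) ≤ 2 * (p / θ ^ 2)) :
    𝔼 a ∈ Fintype.piFinset (fun _ : Fin n => A),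
        𝔼 x, |empirical B a x - proportion A B x| ^ p ≤
      (60 * θ) ^ p * 𝔼 x, proportion A B x ^ (p / 2) := by
  have hp0 : 0 < p := by linarith
  have hn0 : (0 : ℝ) < n := lt_of_lt_of_le (by positivity) hn
  set M := 𝔼 x, proportion A B x ^ (p / 2) with hM
  have hM0 : 0 < M := expect_proportion_rpow_pos hA hB (by linarith)
  have hpn : p / n ≤ θ ^ 2 := by
    rw [div_le_iff₀ (by positivity)] at hn
    rw [div_le_iff₀ hn0]; linarith
  have hθp : (θ ^ 2) ^ (p / 2) = θ ^ p := by
    rw [← Real.rpow_natCast, ← Real.rpow_mul hθ.le]; congr 1; push_cast; ring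
  -- The hypothesis θ² ≤ |B|/|A + B| is what lets M absorb the Poisson term.
  have hdens : (B.dens : ℝ) * (θ ^ p / θ ^ 2) ≤ M := by
    refine le_trans ?_ (dens_mul_rpow_le_expect_proportion_rpow hA hB
      (show 1 ≤ p / 2 by linarith))
    have : θ ^ p / θ ^ 2 = (θ ^ 2) ^ (p / 2 - 1) := by
      rw [Real.rpow_sub_one (by positivity), hθp]
    rw [this]
    gcongr
    linarith
  have hpt : ∀ x, 𝔼 a ∈ Fintype.piFinset (fun _ : Fin n => A),
      |empirical B a x - proportion A B x| ^ p ≤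
      20 ^ p * (θ ^ p * proportion A B x ^ (p / 2) +
        2 * p * θ ^ p * (θ ^ p / θ ^ 2) * proportion A B x) := by
    intro x
    have hq0 := proportion_nonneg A B x
    have h1 := expect_abs_hits_sub_rpow_le (n := n) (D := reflect B x) hA hp
      (q := proportion A B x) rfl
    have h2 : ∀ a : Fin n → G, |empirical B a x - proportion A B x| ^ p =
        |(hits (reflect B x) a : ℝ) - n * proportion A B x| ^ p / (n : ℝ) ^ p := by
      intro a
      rw [← Real.div_rpow (abs_nonneg _) hn0.le]
      congr 1
      rw [← abs_of_pos hn0, ← abs_div, abs_of_pos hn0, sub_div, mul_div_cancel_left₀ _ hn0.ne']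
      rfl
    simp only [h2]
    rw [← Finset.expect_div, div_le_iff₀ (by positivity)]
    refine h1.trans ?_
    rw [mul_assoc]
    refine mul_le_mul_of_nonneg_left ?_ (by positivity)
    rw [add_mul]
    refine add_le_add ?_ ?_
    · have e : (p * (n * proportion A B x)) ^ (p / 2) =
          (p / n) ^ (p / 2) * proportion A B x ^ (p / 2) * (n : ℝ) ^ p := by
        have hnp : (n : ℝ) ^ p = ((n : ℝ) ^ 2) ^ (p / 2) := by
          rw [← Real.rpow_natCast, ← Real.rpow_mul hn0.le]; congr 1; push_cast; ring
        rw [hnp, ← Real.mul_rpow (by positivity) hq0,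
          ← Real.mul_rpow (by positivity) (by positivity)]
        congr 1; field_simp
      rw [e, ← hθp]
      gcongr
    · have e : p ^ p * (n * proportion A B x) =
          (p / n) ^ p * n * proportion A B x * (n : ℝ) ^ p := by
        rw [Real.div_rpow hp0.le hn0.le]; field_simp
      rw [e]
      have h3 : (p / n) ^ p ≤ θ ^ p * θ ^ p := by
        rw [← Real.mul_rpow hθ.le hθ.le, ← pow_two]
        gcongr
      have h4 : (p / n) ^ p * n ≤ 2 * p * θ ^ p * (θ ^ p / θ ^ 2) := by
        calc (p / n) ^ p * n ≤ θ ^ p * θ ^ p * (2 * (p / θ ^ 2)) := by gcongr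
          _ = 2 * p * θ ^ p * (θ ^ p / θ ^ 2) := by ring
      gcongr
  rw [Finset.expect_comm]
  calc 𝔼 x, 𝔼 a ∈ Fintype.piFinset (fun _ : Fin n => A),
        |empirical B a x - proportion A B x| ^ p
      ≤ 𝔼 x, 20 ^ p * (θ ^ p * proportion A B x ^ (p / 2) +
        2 * p * θ ^ p * (θ ^ p / θ ^ 2) * proportion A B x) :=
        Finset.expect_le_expect fun x _ => hpt x
    _ = 20 ^ p * (θ ^ p * M + 2 * p * θ ^ p * (B.dens * (θ ^ p / θ ^ 2))) := by
        rw [← Finset.mul_expect, Finset.expect_add_distrib, ← Finset.mul_expect,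
          ← Finset.mul_expect, expect_proportion hA, hM]
        ring
    _ ≤ 20 ^ p * (θ ^ p * M + 2 * p * θ ^ p * M) := by gcongr
    _ = 20 ^ p * θ ^ p * (1 + p * 2) * M := by ring
    -- Bernoulli's inequality, 1 + 2p ≤ 3^p; hence 60 = 20 · 3.
    _ ≤ 20 ^ p * θ ^ p * 3 ^ p * M := by
        gcongr
        have := one_add_mul_self_le_rpow_one_add (s := 2) (by norm_num) (p := p) (by linarith)
        norm_num at this
        exact this
    _ = (60 * θ) ^ p * M := by
        rw [mul_right_comm (20 ^ p), ← Real.mul_rpow (by norm_num) (by norm_num),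
          ← Real.mul_rpow (by norm_num) hθ.le]
        norm_num

/-- Markov's inequality. -/
lemma card_le_two_mul_card_filter {ι : Type*} (s : Finset ι) (F : ι → ℝ) {Q : ℝ} (hQ : 0 < Q)
    (hF : ∀ i, 0 ≤ F i) (h : 𝔼 i ∈ s, F i ≤ Q) :
    (s.card : ℝ) ≤ 2 * (s.filter fun i => F i ≤ 2 * Q).card := by
  rcases s.eq_empty_or_nonempty with rfl | hs
  · simp
  have hs0 : (0 : ℝ) < s.card := by exact_mod_cast hs.card_pos
  rw [Finset.expect_eq_sum_div_card, div_le_iff₀ hs0] at h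
  have h1 : ((s.filter fun i => ¬ F i ≤ 2 * Q).card : ℝ) * (2 * Q) ≤ ∑ i ∈ s, F i := by
    rw [← nsmul_eq_mul]
    refine (Finset.card_nsmul_le_sum _ F (2 * Q) fun i hi => ?_).trans
      (Finset.sum_le_sum_of_subset_of_nonneg (Finset.filter_subset _ _) fun i _ _ => hF i)
    exact (not_le.1 (Finset.mem_filter.1 hi).2).le
  have h2 : ((s.filter fun i => F i ≤ 2 * Q).card : ℝ) +
      (s.filter fun i => ¬ F i ≤ 2 * Q).card = s.card := by
    exact_mod_cast Finset.card_filter_add_card_filter_not _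
  have h3 : (2 * ((s.filter fun i => ¬ F i ≤ 2 * Q).card : ℝ)) * Q ≤ s.card * Q := by linarith
  have h4 := le_of_mul_le_mul_right h3 hQ
  linarith

/-- Double counting: each pair (l, t) ∈ L × B gives u = l + t in (A + B)ⁿ, so some u is hit at least
the average number of times. -/
lemma exists_card_filter_sub_mem {n : ℕ} (hA : A.Nonempty) (hB : B.Nonempty)
    (L : Finset (Fin n → G)) (hL : L ⊆ Fintype.piFinset fun _ => A) :
    ∃ u : Fin n → G, L.card * B.card ≤
      (A + B).card ^ n * (B.filter fun t => (fun i => u i - t) ∈ L).card := by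
  classical
  have hne : (Fintype.piFinset fun _ : Fin n => A + B).Nonempty :=
    Fintype.piFinset_nonempty.2 fun _ => hA.add hB
  have hcard : (Fintype.piFinset fun _ : Fin n => A + B).card = (A + B).card ^ n := by
    simp [Fintype.card_piFinset]
  have hsum : L.card * B.card ≤ ∑ u ∈ Fintype.piFinset (fun _ : Fin n => A + B),
      (B.filter fun t => (fun i => u i - t) ∈ L).card := by
    simp only [Finset.card_filter]
    rw [Finset.sum_comm, mul_comm, ← smul_eq_mul]
    refine Finset.card_nsmul_le_sum _ _ _ fun t ht => ?_
    rw [← Finset.card_filter]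
    refine Finset.card_le_card_of_injOn (fun l i => l i + t) (fun l hl => ?_) ?_
    · have hl' := Fintype.mem_piFinset.1 (hL hl)
      simp only [Finset.coe_filter, Set.mem_ofPred_eq, Fintype.mem_piFinset, add_sub_cancel_right]
      exact ⟨fun i => Finset.add_mem_add (hl' i) ht, hl⟩
    · intro l _ l' _ h
      funext i
      exact add_right_cancel (congrFun h i)
  by_contra! hcon
  have h2 : (A + B).card ^ n * ∑ u ∈ Fintype.piFinset (fun _ : Fin n => A + B),
      (B.filter fun t => (fun i => u i - t) ∈ L).card < (A + B).card ^ n * (L.card * B.card) := by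
    rw [Finset.mul_sum, ← hcard, ← smul_eq_mul _ (L.card * B.card), ← Finset.sum_const, hcard]
    exact Finset.sum_lt_sum_of_nonempty hne fun u _ => hcon u
  exact absurd hsum (not_le.2 (lt_of_mul_lt_mul_left h2 (Nat.zero_le _)))

lemma normLp_convolution_rpow_half {p : ℝ} (hp : 2 ≤ p) (A B : Finset G) :
    normLp (p / 2) (convolution (normInd A) (ind B)) ^ ((1 : ℝ) / 2) =
      (𝔼 x, proportion A B x ^ (p / 2)) ^ (1 / p) := by
  have h : ∀ x, ‖convolution (normInd A) (ind B) x‖ = proportion A B x := fun x => by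
    rw [convolution_normInd_ind, Complex.norm_real, Real.norm_of_nonneg (proportion_nonneg A B x)]
  simp only [normLp, h]
  rw [← Real.rpow_mul]
  · congr 1; field_simp
  · exact Finset.expect_nonneg fun x _ => Real.rpow_nonneg (proportion_nonneg A B x) _

/-- The `L^p` almost-periodicity of `μ_A * 1_B`: the translates by differences of elements of a
large subset of `B` are close to the original function. -/
theorem exists_subset_forall_normLp_translate_sub_le (hA : A.Nonempty) (hB : B.Nonempty)
    {p θ K : ℝ} (hK : ((A + B).card : ℝ) ≤ K * A.card) (hp : 2 ≤ p) (hθ : 0 < θ)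
    (hθB : θ ^ 2 ≤ (B.card : ℝ) / (A + B).card) {n : ℕ} (hn : p / θ ^ 2 ≤ n)
    (hn' : (n : ℝ) ≤ 2 * (p / θ ^ 2)) :
    ∃ T : Finset G, T.Nonempty ∧ (B.card : ℝ) ≤ 2 * K ^ n * T.card ∧ ∀ t ∈ T, ∀ t' ∈ T,
      normLp p (fun x => convolution (normInd A) (ind B) (x + (t - t'))
        - convolution (normInd A) (ind B) x) ≤
      240 * θ * normLp (p / 2) (convolution (normInd A) (ind B)) ^ ((1 : ℝ) / 2) := by
  have hp0 : 0 < p := by linarith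
  have hA0 : (0 : ℝ) < A.card := by exact_mod_cast hA.card_pos
  have hB0 : (0 : ℝ) < B.card := by exact_mod_cast hB.card_pos
  have hAB0 : (0 : ℝ) < (A + B).card := by exact_mod_cast (hA.add hB).card_pos
  have hK0 : 0 < K := pos_of_mul_pos_left (hAB0.trans_le hK) hA0.le
  rw [normLp_convolution_rpow_half hp]
  set M := 𝔼 x, proportion A B x ^ (p / 2) with hM
  have hM0 : 0 < M := expect_proportion_rpow_pos hA hB (by linarith)
  have hMp : (M ^ (1 / p)) ^ p = M := by
    rw [← Real.rpow_mul hM0.le, one_div_mul_cancel hp0.ne', Real.rpow_one]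
  set F : (Fin n → G) → ℝ := fun a => 𝔼 x, |empirical B a x - proportion A B x| ^ p with hF
  set L := (Fintype.piFinset fun _ : Fin n => A).filter
    fun a => F a ≤ 2 * ((60 * θ) ^ p * M) with hL
  have hLcard : (A.card : ℝ) ^ n ≤ 2 * L.card := by
    have := card_le_two_mul_card_filter (Fintype.piFinset fun _ : Fin n => A) F
      (Q := (60 * θ) ^ p * M) (by positivity)
      (fun a => Finset.expect_nonneg fun x _ => by positivity)
      (expect_empirical_sub_rpow_le hA hB hp hθ hθB hn hn')
    simpa [Fintype.card_piFinset] using this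
  obtain ⟨u, hu⟩ := exists_card_filter_sub_mem hA hB L (Finset.filter_subset _ _)
  set T := B.filter fun t => (fun i => u i - t) ∈ L with hT
  have hu' : (L.card : ℝ) * B.card ≤ ((A + B).card : ℝ) ^ n * T.card := by exact_mod_cast hu
  have hTcard : (B.card : ℝ) ≤ 2 * K ^ n * T.card := by
    have h1 : (A.card : ℝ) ^ n * B.card ≤ (A.card : ℝ) ^ n * (2 * K ^ n * T.card) := by
      calc (A.card : ℝ) ^ n * B.card ≤ 2 * L.card * B.card := by gcongr
        _ = 2 * (L.card * B.card) := by ring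
        _ ≤ 2 * (((A + B).card : ℝ) ^ n * T.card) := by gcongr
        _ ≤ 2 * ((K * A.card) ^ n * T.card) := by gcongr
        _ = _ := by rw [mul_pow]; ring
    exact le_of_mul_le_mul_left h1 (by positivity)
  refine ⟨T, ?_, hTcard, ?_⟩
  · rw [Finset.nonempty_iff_ne_empty]
    rintro h
    rw [h] at hTcard
    simp at hTcard
    exact hB.ne_empty hTcard
  set f := convolution (normInd A) (ind B) with hf
  have hclose : ∀ t ∈ T, normLp p (fun x => (empirical B u (x + t) : ℂ) - f x) ≤
      120 * θ * M ^ (1 / p) := by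
    intro t ht
    have h1 := (Finset.mem_filter.1 (Finset.mem_filter.1 ht).2).2
    rw [normLp_le_iff (by linarith) _ (by positivity), Real.mul_rpow (by positivity)
      (by positivity), hMp]
    -- The factor 2 lost to Markov's inequality is absorbed by 2 ≤ 2^p.
    have h2 : (2 : ℝ) * (60 * θ) ^ p ≤ (120 * θ) ^ p := by
      have h3 : (2 : ℝ) ≤ 2 ^ p := by
        simpa using Real.rpow_le_rpow_of_exponent_le (x := 2) (by norm_num)
          (show (1 : ℝ) ≤ p by linarith)
      calc (2 : ℝ) * (60 * θ) ^ p ≤ 2 ^ p * (60 * θ) ^ p := by gcongr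
        _ = (120 * θ) ^ p := by
          rw [← Real.mul_rpow (by norm_num) (by positivity)]; congr 1; ring
    calc 𝔼 x, ‖(empirical B u (x + t) : ℂ) - f x‖ ^ p = F fun i => u i - t := by
          refine Finset.expect_congr rfl fun x _ => ?_
          rw [hf, convolution_normInd_ind, ← Complex.ofReal_sub, Complex.norm_real,
            Real.norm_eq_abs, empirical_sub]
      _ ≤ 2 * ((60 * θ) ^ p * M) := h1
      _ ≤ (120 * θ) ^ p * M := by rw [← mul_assoc]; gcongr
  intro t ht t' ht'
  -- After translation by -t, both functions are compared with the same `empirical B u`, at cost 120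
  -- θ each.
  rw [← normLp_translate p _ (-t)]
  have h1 := hclose t ht
  have h2 := hclose t' ht'
  rw [← normLp_translate p _ (-t)] at h1
  rw [← normLp_translate p _ (-t'), normLp_sub_comm] at h2
  simp only [neg_add_cancel_right] at h1 h2
  have h3 := normLp_sub_le (p := p) (by linarith) (fun x => f (x + -t'))
    (fun x => (empirical B u x : ℂ)) (fun x => f (x + -t))
  refine le_trans (le_of_eq ?_) (h3.trans ((add_le_add h2 h1).trans (le_of_eq (by ring))))
  congr 1
  funext x
  rw [show x + -t + (t - t') = x + -t' by abel]

end Sampling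

/-! ### Chang's theorem on large spectra -/

section Chang

variable {G : Type*} [AddCommGroup G]

/-- The average of the character `γ` over the set `T`. -/
noncomputable def charAvg (T : Finset G) (γ : AddChar G ℂ) : ℂ := 𝔼 t ∈ T, γ t

lemma norm_apply_eq_one [Finite G] (γ : AddChar G ℂ) (x : G) : ‖γ x‖ = 1 := γ.norm_apply x

lemma norm_charAvg_le_one [Finite G] (T : Finset G) (γ : AddChar G ℂ) : ‖charAvg T γ‖ ≤ 1 := by
  rw [charAvg, Finset.expect_eq_sum_div_card, norm_div, Complex.norm_natCast]
  refine div_le_one_of_le₀ ((norm_sum_le _ _).trans ?_) (by positivity)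
  simp

/-- Rudin's inequality. By convexity exp(s y) ≤ cosh s + y sinh s for |y| ≤ 1, which leads to a
Riesz product; dissociativity removes all but its constant term, and cosh s ≤ exp(s²/2). -/
lemma expect_exp_le_of_addDissociated [Fintype G] (Λ : Finset (AddChar G ℂ))
    (hΛ : AddDissociated (Λ : Set (AddChar G ℂ))) (c : AddChar G ℂ → ℂ) (hc : ∀ γ, ‖c γ‖ ≤ 1)
    (s : ℝ) :
    𝔼 x, Real.exp (s * ∑ γ ∈ Λ, (c γ * γ x).re) ≤ Real.exp (Λ.card * (s ^ 2 / 2)) := by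
  classical
  have hrand := AddDissociated.randomisation (fun ψ => if ψ ∈ Λ then Real.cosh s else 1)
    (fun ψ => if ψ ∈ Λ then (Real.sinh s : ℂ) * c ψ else 0)
    (hΛ.subset fun ψ hψ => by
      by_contra h
      exact hψ (if_neg h))
  have hprod : ∀ x : G, ∏ ψ : AddChar G ℂ, ((if ψ ∈ Λ then Real.cosh s else 1) +
      ((if ψ ∈ Λ then (Real.sinh s : ℂ) * c ψ else 0) * ψ x).re) =
      ∏ ψ ∈ Λ, (Real.cosh s + (c ψ * ψ x).re * Real.sinh s) := by
    intro x
    rw [← Finset.prod_subset (Finset.subset_univ Λ)]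
    · refine Finset.prod_congr rfl fun ψ hψ => ?_
      rw [if_pos hψ, if_pos hψ, mul_assoc, Complex.re_ofReal_mul, mul_comm (Real.sinh s)]
    · intro ψ _ hψ
      simp [hψ]
  simp only [hprod] at hrand
  have hc2 : ∏ ψ : AddChar G ℂ, (if ψ ∈ Λ then Real.cosh s else 1) = Real.cosh s ^ Λ.card := by
    rw [Finset.prod_ite_mem, Finset.univ_inter, Finset.prod_const]
  rw [hc2] at hrand
  calc 𝔼 x, Real.exp (s * ∑ γ ∈ Λ, (c γ * γ x).re)
      ≤ 𝔼 x, ∏ ψ ∈ Λ, (Real.cosh s + (c ψ * ψ x).re * Real.sinh s) := by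
        refine Finset.expect_le_expect fun x _ => ?_
        rw [Finset.mul_sum, Real.exp_sum]
        refine Finset.prod_le_prod (fun _ _ => (Real.exp_pos _).le) fun γ _ => ?_
        rw [mul_comm s]
        refine Real.exp_mul_le_cosh_add_mul_sinh ((Complex.abs_re_le_norm _).trans ?_) s
        rw [norm_mul, norm_apply_eq_one, mul_one]
        exact hc γ
    _ = Real.cosh s ^ Λ.card := hrand
    _ ≤ Real.exp (s ^ 2 / 2) ^ Λ.card := by
        gcongr
        exact Real.cosh_le_exp_half_sq s
    _ = Real.exp (Λ.card * (s ^ 2 / 2)) := by rw [← Real.exp_nat_mul]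

/-- The phases c align the characters, so Y averages at least |Λ|/2 on T. Jensen then bounds the
mean of exp(Y/2) on T below by exp(|Λ|/4), whereas Rudin's inequality bounds its mean on G above by
exp(|Λ|/8). The ratio is at most the inverse density of T. -/
lemma card_le_of_addDissociated [Fintype G] {T : Finset G} (hT : T.Nonempty)
    (Λ : Finset (AddChar G ℂ)) (hΛ : AddDissociated (Λ : Set (AddChar G ℂ)))
    (h : ∀ γ ∈ Λ, 1 / 2 ≤ ‖charAvg T γ‖) :
    (Λ.card : ℝ) ≤ 8 * Real.log ((T.dens : ℝ)⁻¹) := by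
  have hT0 : (0 : ℝ) < T.card := by exact_mod_cast hT.card_pos
  have hG0 : (0 : ℝ) < Fintype.card G := by exact_mod_cast Fintype.card_pos
  have hdens0 : (0 : ℝ) < T.dens := by exact_mod_cast hT.dens_pos
  set c : AddChar G ℂ → ℂ := fun γ => (starRingEnd ℂ) (charAvg T γ) / ‖charAvg T γ‖ with hc
  have hc1 : ∀ γ, ‖c γ‖ ≤ 1 := fun γ => by
    simp only [hc, norm_div, RCLike.norm_conj, Complex.norm_real, norm_norm]
    exact div_self_le_one _
  have hexp := expect_exp_le_of_addDissociated Λ hΛ c hc1 (1 / 2)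
  set Y : G → ℝ := fun x => ∑ γ ∈ Λ, (c γ * γ x).re with hY
  have hmean : (Λ.card : ℝ) / 2 * T.card ≤ ∑ t ∈ T, Y t := by
    simp only [hY]
    rw [Finset.sum_comm]
    have : ∀ γ ∈ Λ, (T.card : ℝ) / 2 ≤ ∑ t ∈ T, (c γ * γ t).re := by
      intro γ hγ
      rw [← Complex.re_sum, ← Finset.mul_sum]
      have h1 : ∑ t ∈ T, γ t = T.card * charAvg T γ := by
        rw [charAvg, Finset.card_mul_expect]
      have h2 : c γ * ∑ t ∈ T, γ t = ((T.card * ‖charAvg T γ‖ : ℝ) : ℂ) := by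
        have h0 : (‖charAvg T γ‖ : ℂ) ≠ 0 := by
          have := h γ hγ
          exact_mod_cast (show ‖charAvg T γ‖ ≠ 0 by linarith)
        rw [h1, hc]
        push_cast
        rw [div_mul_eq_mul_div, div_eq_iff h0, mul_left_comm, Complex.conj_mul']
        ring
      rw [h2, Complex.ofReal_re]
      nlinarith [h γ hγ]
    calc (Λ.card : ℝ) / 2 * T.card = ∑ γ ∈ Λ, (T.card : ℝ) / 2 := by
          rw [Finset.sum_const, nsmul_eq_mul]; ring
      _ ≤ _ := Finset.sum_le_sum this
  have hlow : T.card * Real.exp (Λ.card / 4) ≤ ∑ t ∈ T, Real.exp (1 / 2 * Y t) := by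
    -- Jensen by hand: the tangent line to exp at |Λ|/4.
    have h1 : ∀ t ∈ T, Real.exp (Λ.card / 4) * (1 + (1 / 2 * Y t - Λ.card / 4)) ≤
        Real.exp (1 / 2 * Y t) := by
      intro t _
      have h2 : Real.exp (1 / 2 * Y t) =
          Real.exp (Λ.card / 4) * Real.exp (1 / 2 * Y t - Λ.card / 4) := by
        rw [← Real.exp_add]; congr 1; ring
      rw [h2]
      gcongr
      linarith [Real.add_one_le_exp (1 / 2 * Y t - Λ.card / 4)]
    refine le_trans ?_ (Finset.sum_le_sum h1)
    rw [← Finset.mul_sum, mul_comm]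
    gcongr
    rw [Finset.sum_add_distrib, Finset.sum_sub_distrib, ← Finset.mul_sum]
    simp only [Finset.sum_const, nsmul_eq_mul, mul_one]
    linarith
  have hup : ∑ t ∈ T, Real.exp (1 / 2 * Y t) ≤
      Fintype.card G * Real.exp (Λ.card * ((1 / 2) ^ 2 / 2)) := by
    refine le_trans (Finset.sum_le_sum_of_subset_of_nonneg (Finset.subset_univ T)
      fun x _ _ => (Real.exp_pos _).le) ?_
    rw [Fintype.expect_eq_sum_div_card, div_le_iff₀ hG0] at hexp
    linarith
  have hfin : Real.exp (Λ.card / 8) ≤ (T.dens : ℝ)⁻¹ := by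
    have h1 : Real.exp ((Λ.card : ℝ) / 4) = Real.exp (Λ.card / 8) * Real.exp (Λ.card / 8) := by
      rw [← Real.exp_add]; congr 1; ring
    have h2 : (Λ.card : ℝ) * ((1 / 2) ^ 2 / 2) = Λ.card / 8 := by ring
    have h3 := hlow.trans hup
    rw [h1, h2, ← mul_assoc] at h3
    have h4 := le_of_mul_le_mul_right h3 (Real.exp_pos _)
    rw [Finset.dens]
    push_cast
    rw [inv_div, le_div_iff₀ hT0]
    linarith
  have := (Real.le_log_iff_exp_le (by positivity)).2 hfin
  linarith

lemma norm_sum_apply_sub_one_le [Finite G] {ι : Type*} (s : Finset ι) (g : ι → AddChar G ℂ)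
    (x : G) : ‖(∑ i ∈ s, g i) x - 1‖ ≤ ∑ i ∈ s, ‖g i x - 1‖ := by
  classical
  induction s using Finset.induction_on with
  | empty => simp
  | insert i s hi ih =>
    rw [Finset.sum_insert hi, Finset.sum_insert hi, AddChar.add_apply]
    have h : g i x * (∑ i ∈ s, g i) x - 1 =
        g i x * ((∑ i ∈ s, g i) x - 1) + (g i x - 1) := by ring
    rw [h]
    refine (norm_add_le _ _).trans ?_
    rw [norm_mul, norm_apply_eq_one, one_mul, add_comm]
    gcongr

lemma norm_neg_apply_sub_one [Finite G] (γ : AddChar G ℂ) (x : G) :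
    ‖(-γ) x - 1‖ = ‖γ x - 1‖ := by
  have h : (-γ) x - 1 = (starRingEnd ℂ) (γ x - 1) := by
    rw [map_sub, map_one, ← AddChar.map_neg_eq_conj, AddChar.neg_apply]
  rw [h, RCLike.norm_conj]

lemma norm_apply_sub_one_le_of_mem_addSpan [Finite G] [DecidableEq (AddChar G ℂ)]
    {Γ : Finset (AddChar G ℂ)} {γ : AddChar G ℂ} (hγ : γ ∈ Finset.addSpan Γ) {δ : ℝ} {x : G}
    (hx : x ∈ bohrSet Γ δ) : ‖γ x - 1‖ ≤ Γ.card * δ := by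
  obtain ⟨e, he, rfl⟩ := Finset.mem_addSpan.1 hγ
  refine (norm_sum_apply_sub_one_le _ _ _).trans ?_
  rw [← nsmul_eq_mul]
  refine Finset.sum_le_card_nsmul _ _ _ fun ψ hψ => ?_
  have h0 : ‖ψ x - 1‖ ≤ δ := hx ψ hψ
  rcases he ψ with h | h | h <;> rw [h]
  · rwa [neg_one_zsmul, norm_neg_apply_sub_one]
  · simpa using (norm_nonneg _).trans h0
  · rwa [one_zsmul]

/-- **Chang's theorem**: the large spectrum of `T` is controlled by few characters. -/
theorem exists_forall_mem_bohrSet_norm_sub_one_le [Fintype G] {T : Finset G} (hT : T.Nonempty) :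
    ∃ Γ : Finset (AddChar G ℂ), Γ.Nonempty ∧
      (Γ.card : ℝ) ≤ 8 * Real.log ((T.dens : ℝ)⁻¹) + 1 ∧
      ∀ δ : ℝ, ∀ x ∈ bohrSet Γ δ, ∀ γ : AddChar G ℂ, 1 / 2 ≤ ‖charAvg T γ‖ →
        ‖γ x - 1‖ ≤ Γ.card * δ := by
  classical
  have hlog : 0 ≤ 8 * Real.log ((T.dens : ℝ)⁻¹) := by
    have := card_le_of_addDissociated hT ∅ (by simp) (by simp)
    simpa using this
  obtain ⟨Γ, -, hcard, hspan⟩ :=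
    Finset.exists_subset_addSpan_card_le_of_forall_addDissociated
      (s := Finset.univ.filter fun γ : AddChar G ℂ => 1 / 2 ≤ ‖charAvg T γ‖)
      (d := ⌊8 * Real.log ((T.dens : ℝ)⁻¹)⌋₊) fun Λ hΛ hdis => Nat.le_floor
        (card_le_of_addDissociated hT Λ hdis fun γ hγ => (Finset.mem_filter.1 (hΛ hγ)).2)
  have hle : (Γ.card : ℝ) ≤ 8 * Real.log ((T.dens : ℝ)⁻¹) := (Nat.le_floor_iff hlog).1 hcard
  -- The trivial character makes Γ non-empty and forces δ ≥ 0 on a non-empty Bohr set; it costs the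
  -- + 1 in the bound.
  refine ⟨insert 0 Γ, Finset.insert_nonempty _ _, ?_, fun δ x hx γ hγ => ?_⟩
  · have : ((insert 0 Γ).card : ℝ) ≤ Γ.card + 1 := by exact_mod_cast Finset.card_insert_le _ _
    linarith
  · have hδ : 0 ≤ δ := (norm_nonneg _).trans (hx 0 (Finset.mem_insert_self _ _))
    refine (norm_apply_sub_one_le_of_mem_addSpan (hspan (by simpa using hγ))
      (δ := δ) fun ψ hψ => hx ψ (Finset.mem_insert_of_mem hψ)).trans ?_
    gcongr
    exact Finset.subset_insert _ _

end Chang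

/-! ### Fourier analysis and smoothing by μ_T * μ_{-T} -/

section Fourier

variable {G : Type*} [AddCommGroup G] [Fintype G]

/-- The Fourier coefficient `𝔼ₓ f(x) γ(-x)`. -/
noncomputable def fourierCoeff (f : G → ℂ) (γ : AddChar G ℂ) : ℂ := 𝔼 x, f x * γ (-x)

/-- The function with Fourier coefficients `c`. -/
noncomputable def trigSum (c : AddChar G ℂ → ℂ) (x : G) : ℂ := ∑ γ, c γ * γ x

lemma trigSum_fourierCoeff (f : G → ℂ) : trigSum (fourierCoeff f) = f := by
  classical
  funext x
  have hG : (Fintype.card G : ℂ) ≠ 0 := by exact_mod_cast Fintype.card_ne_zero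
  simp only [trigSum, fourierCoeff, Finset.expect_mul]
  rw [← Finset.expect_sum_comm]
  have h : ∀ y : G, ∑ γ : AddChar G ℂ, f y * γ (-y) * γ x =
      if y = x then (Fintype.card G : ℂ) * f x else 0 := by
    intro y
    have h1 : ∀ γ : AddChar G ℂ, f y * γ (-y) * γ x = f y * γ (x - y) := fun γ => by
      rw [mul_assoc, ← AddChar.map_add_eq_mul, neg_add_eq_sub]
    simp only [h1]
    rw [← Finset.mul_sum, AddChar.sum_apply_eq_ite]
    by_cases hxy : y = x
    · subst hxy; simp [mul_comm]
    · rw [if_neg hxy, if_neg (sub_ne_zero.2 (Ne.symm hxy)), mul_zero]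
  simp only [h]
  rw [Fintype.expect_eq_sum_div_card]
  simp [hG]

lemma expect_norm_trigSum_sq (c : AddChar G ℂ → ℂ) :
    𝔼 x, ‖trigSum c x‖ ^ 2 = ∑ γ, ‖c γ‖ ^ 2 := by
  classical
  apply Complex.ofReal_injective
  push_cast
  have h : ∀ x, (‖trigSum c x‖ : ℂ) ^ 2 =
      ∑ γ, ∑ ψ, c γ * conj (c ψ) * (γ - ψ) x := by
    intro x
    rw [← Complex.mul_conj', trigSum, map_sum, Finset.sum_mul_sum]
    refine Finset.sum_congr rfl fun γ _ => Finset.sum_congr rfl fun ψ _ => ?_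
    rw [map_mul, AddChar.sub_apply, AddChar.map_neg_eq_conj]
    ring
  simp only [h]
  rw [Finset.expect_sum_comm]
  refine Finset.sum_congr rfl fun γ _ => ?_
  rw [Finset.expect_sum_comm]
  simp only [← Finset.mul_expect, AddChar.expect_eq_ite, sub_eq_zero]
  simp [Complex.mul_conj']

lemma sum_norm_fourierCoeff_sq (f : G → ℂ) :
    ∑ γ, ‖fourierCoeff f γ‖ ^ 2 = 𝔼 x, ‖f x‖ ^ 2 := by
  rw [← expect_norm_trigSum_sq, trigSum_fourierCoeff]

lemma fourierCoeff_convolution (f g : G → ℂ) (γ : AddChar G ℂ) :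
    fourierCoeff (convolution f g) γ = fourierCoeff f γ * fourierCoeff g γ := by
  simp only [fourierCoeff, convolution, Finset.expect_mul]
  rw [Finset.expect_comm]
  refine Finset.expect_congr rfl fun y _ => ?_
  rw [Finset.mul_expect]
  refine Fintype.expect_equiv (Equiv.subRight y) _ _ fun x => ?_
  rw [Equiv.subRight_apply, show -x = -y + -(x - y) by abel, AddChar.map_add_eq_mul]
  ring

/-- The convolution of `f` with `μ_T` and `μ_{-T}`. -/
noncomputable def smooth (T : Finset G) (f : G → ℂ) (x : G) : ℂ :=
  𝔼 q ∈ T ×ˢ T, f (x + (q.1 - q.2))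

lemma smooth_trigSum (T : Finset G) (c : AddChar G ℂ → ℂ) :
    smooth T (trigSum c) = trigSum fun γ => c γ * (‖charAvg T γ‖ : ℂ) ^ 2 := by
  funext x
  simp only [smooth, trigSum]
  rw [Finset.expect_sum_comm]
  refine Finset.sum_congr rfl fun γ _ => ?_
  have h : ∀ q : G × G, c γ * γ (x + (q.1 - q.2)) = c γ * γ x * (γ q.1 * conj (γ q.2)) := by
    intro q
    rw [AddChar.map_add_eq_mul, sub_eq_add_neg, AddChar.map_add_eq_mul, AddChar.map_neg_eq_conj]
    ring
  simp only [h]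
  rw [← Finset.mul_expect, Finset.expect_product, ← Complex.mul_conj', charAvg]
  simp only [← Finset.mul_expect]
  rw [← Finset.expect_mul, map_expect]
  ring

lemma iterate_smooth_trigSum (T : Finset G) (c : AddChar G ℂ → ℂ) (k : ℕ) :
    (smooth T)^[k] (trigSum c) = trigSum fun γ => c γ * (‖charAvg T γ‖ : ℂ) ^ (2 * k) := by
  induction k with
  | zero => simp
  | succ k ih =>
    rw [Function.iterate_succ_apply', ih, smooth_trigSum]
    congr 1
    funext γ
    ring

lemma normLp_smooth_le {p : ℝ} (hp : 1 ≤ p) {T : Finset G} (hT : T.Nonempty) (f : G → ℂ) :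
    normLp p (smooth T f) ≤ normLp p f :=
  normLp_expect_le hp _ (hT.product hT) (fun q x => f (x + (q.1 - q.2))) (normLp_nonneg _ _)
    fun _ _ => (normLp_translate _ _ _).le

lemma normLp_smooth_sub_le {p : ℝ} (hp : 1 ≤ p) {T : Finset G} (hT : T.Nonempty) (f : G → ℂ)
    {τ : ℝ} (hτ : 0 ≤ τ)
    (h : ∀ t ∈ T, ∀ t' ∈ T, normLp p (fun x => f (x + (t - t')) - f x) ≤ τ) :
    normLp p (fun x => smooth T f x - f x) ≤ τ := by
  have h1 := normLp_expect_le hp (T ×ˢ T) (hT.product hT)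
    (fun q x => f (x + (q.1 - q.2)) - f x) hτ fun q hq =>
      h _ (Finset.mem_product.1 hq).1 _ (Finset.mem_product.1 hq).2
  simpa only [Finset.expect_sub_distrib, Finset.expect_const (hT.product hT)] using! h1

/-- Smoothing is a linear contraction moving f by at most τ, so errors add up along the iteration.
This is why single translates need accuracy of order ε/k. -/
lemma normLp_iterate_smooth_sub_le {p : ℝ} (hp : 1 ≤ p) {T : Finset G} (hT : T.Nonempty)
    (f : G → ℂ) {τ : ℝ} (hτ : 0 ≤ τ)
    (h : ∀ t ∈ T, ∀ t' ∈ T, normLp p (fun x => f (x + (t - t')) - f x) ≤ τ) (k : ℕ) :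
    normLp p (fun x => (smooth T)^[k] f x - f x) ≤ k * τ := by
  induction k with
  | zero =>
    simp only [Function.iterate_zero, id_eq, sub_self]
    rw [normLp_le_iff hp _ (by simp)]
    simp [Real.zero_rpow (by linarith : p ≠ 0)]
  | succ k ih =>
    rw [Function.iterate_succ_apply']
    refine (normLp_sub_le hp _ (smooth T f) _).trans ?_
    have h1 : (fun x => smooth T ((smooth T)^[k] f) x - smooth T f x) =
        smooth T fun x => (smooth T)^[k] f x - f x := by
      funext x
      simp only [smooth, Finset.expect_sub_distrib]
    rw [h1]
    have h2 := (normLp_smooth_le hp hT fun x => (smooth T)^[k] f x - f x).trans ih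
    have h3 := normLp_smooth_sub_le hp hT f hτ h
    push_cast
    linarith

lemma norm_trigSum_le (c : AddChar G ℂ → ℂ) (x : G) : ‖trigSum c x‖ ≤ ∑ γ, ‖c γ‖ := by
  refine (norm_sum_le _ _).trans (le_of_eq ?_)
  simp only [norm_mul, norm_apply_eq_one, mul_one]

/-- Of the p factors, p - 2 are bounded in sup norm by the sum of the coefficients and the last two
are handled by Parseval. -/
lemma expect_norm_trigSum_rpow_le {p : ℝ} (hp : 2 ≤ p) (c w : AddChar G ℂ → ℂ) {η : ℝ}
    (hw : ∀ γ, ‖w γ‖ ≤ η) :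
    𝔼 x, ‖trigSum (fun γ => c γ * w γ) x‖ ^ p ≤
      (η * ∑ γ, ‖c γ‖) ^ (p - 2) * (η ^ 2 * ∑ γ, ‖c γ‖ ^ 2) := by
  have hη : 0 ≤ η := (norm_nonneg _).trans (hw 0)
  set S := ∑ γ, ‖c γ‖ with hS
  have hsup : ∀ x, ‖trigSum (fun γ => c γ * w γ) x‖ ≤ η * S := by
    intro x
    refine (norm_trigSum_le _ x).trans ?_
    rw [hS, Finset.mul_sum]
    refine Finset.sum_le_sum fun γ _ => ?_
    rw [norm_mul, mul_comm]
    gcongr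
    exact hw γ
  have hpt : ∀ x, ‖trigSum (fun γ => c γ * w γ) x‖ ^ p ≤
      (η * S) ^ (p - 2) * ‖trigSum (fun γ => c γ * w γ) x‖ ^ 2 := by
    intro x
    have h1 : ‖trigSum (fun γ => c γ * w γ) x‖ ^ p =
        ‖trigSum (fun γ => c γ * w γ) x‖ ^ (p - 2) * ‖trigSum (fun γ => c γ * w γ) x‖ ^ 2 := by
      rw [← Real.rpow_two, ← Real.rpow_add_of_nonneg (norm_nonneg _) (by linarith) (by norm_num),
        sub_add_cancel]
    rw [h1]
    gcongr
    exact hsup x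
  have hS0 : 0 ≤ S := Finset.sum_nonneg fun _ _ => norm_nonneg _
  calc 𝔼 x, ‖trigSum (fun γ => c γ * w γ) x‖ ^ p
      ≤ 𝔼 x, (η * S) ^ (p - 2) * ‖trigSum (fun γ => c γ * w γ) x‖ ^ 2 :=
        Finset.expect_le_expect fun x _ => hpt x
    _ = (η * S) ^ (p - 2) * ∑ γ, ‖c γ * w γ‖ ^ 2 := by
        rw [← Finset.mul_expect, expect_norm_trigSum_sq]
    _ ≤ (η * S) ^ (p - 2) * (η ^ 2 * ∑ γ, ‖c γ‖ ^ 2) := by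
        gcongr
        rw [Finset.mul_sum]
        refine Finset.sum_le_sum fun γ _ => ?_
        rw [norm_mul, mul_pow, mul_comm]
        gcongr
        exact hw γ

end Fourier

/-! ### Translates of the smoothed convolution -/

section Spectrum

variable {G : Type*} [AddCommGroup G] [Fintype G] [DecidableEq G] {A B : Finset G}

lemma expect_norm_ind_sq {G : Type*} [Fintype G] [DecidableEq G] (B : Finset G) :
    𝔼 x, ‖ind B x‖ ^ 2 = (B.dens : ℝ) := by
  have h : ∀ x, ‖ind B x‖ ^ 2 = if x ∈ B then (1 : ℝ) else 0 := by
    intro x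
    by_cases hx : x ∈ B <;> simp [ind, hx]
  simp only [h]
  rw [Fintype.expect_eq_sum_div_card, Finset.dens]
  simp

/-- Cauchy–Schwarz and Parseval, as the coefficients are products of those of μ_A and 1_B. -/
lemma sum_norm_fourierCoeff_convolution_le (A B : Finset G) :
    ∑ γ, ‖fourierCoeff (convolution (normInd A) (ind B)) γ‖ ≤
      Real.sqrt ((B.card : ℝ) / A.card) := by
  have hG0 : (0 : ℝ) < Fintype.card G := by exact_mod_cast Fintype.card_pos
  refine Real.le_sqrt_of_sq_le ?_
  simp only [fourierCoeff_convolution, norm_mul]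
  refine (Finset.sum_mul_sq_le_sq_mul_sq _ _ _).trans ?_
  rw [sum_norm_fourierCoeff_sq, sum_norm_fourierCoeff_sq, expect_norm_ind_sq]
  have h : ∀ x, ‖normInd A x‖ ^ 2 = ‖ind A x‖ ^ 2 / (A.dens : ℝ) ^ 2 := by
    intro x
    have h0 : ‖(A.dens : ℂ)‖ = (A.dens : ℝ) := by
      rw [Finset.dens]; push_cast; simp
    rw [normInd, norm_div, div_pow, h0]
  simp only [h]
  rw [← Finset.expect_div, expect_norm_ind_sq, Finset.dens, Finset.dens]
  push_cast
  rcases eq_or_ne (A.card : ℝ) 0 with h0 | h0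
  · simp [h0]
  · refine le_of_eq ?_
    field_simp

/-- Parseval, with one factor of the convolution bounded by its maximum |B|/|A| and the other
averaging to the density of B. -/
lemma sum_norm_fourierCoeff_convolution_sq_le (hA : A.Nonempty) (B : Finset G) :
    ∑ γ, ‖fourierCoeff (convolution (normInd A) (ind B)) γ‖ ^ 2 ≤
      (B.card : ℝ) / A.card * B.dens := by
  rw [sum_norm_fourierCoeff_sq, ← expect_proportion hA B, Finset.mul_expect]
  refine Finset.expect_le_expect fun x _ => ?_
  rw [convolution_normInd_ind, Complex.norm_real, Real.norm_of_nonneg (proportion_nonneg A B x),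
    pow_two]
  exact mul_le_mul_of_nonneg_right (proportion_le A B x) (proportion_nonneg A B x)

/-- Smoothing `μ_A * 1_B` by a set with few large Fourier coefficients makes it invariant under
translates that fix these. -/
lemma normLp_translate_iterate_smooth_sub_le (hA : A.Nonempty) (hB : B.Nonempty) {p K ε : ℝ}
    (hp : 2 ≤ p) (hε : 0 < ε) (hK : ((A + B).card : ℝ) ≤ K * A.card) (T : Finset G) (k : ℕ) (t : G)
    (h : ∀ γ : AddChar G ℂ, ‖charAvg T γ‖ ^ (2 * k) * ‖γ t - 1‖ ≤ ε / Real.sqrt K) :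
    normLp p (fun x => (smooth T)^[k] (convolution (normInd A) (ind B)) (x + t)
        - (smooth T)^[k] (convolution (normInd A) (ind B)) x) ≤
      ε * normLp (p / 2) (convolution (normInd A) (ind B)) ^ ((1 : ℝ) / 2) := by
  have hp0 : 0 < p := by linarith
  have hA0 : (0 : ℝ) < A.card := by exact_mod_cast hA.card_pos
  have hB0 : (0 : ℝ) < B.card := by exact_mod_cast hB.card_pos
  have hAB0 : (0 : ℝ) < (A + B).card := by exact_mod_cast (hA.add hB).card_pos
  have hK0 : 0 < K := pos_of_mul_pos_left (hAB0.trans_le hK) hA0.le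
  have hdens0 : (0 : ℝ) < B.dens := by exact_mod_cast hB.dens_pos
  rw [normLp_convolution_rpow_half hp]
  set M := 𝔼 x, proportion A B x ^ (p / 2) with hM
  have hM0 : 0 < M := expect_proportion_rpow_pos hA hB (by linarith)
  have hMp : (M ^ (1 / p)) ^ p = M := by
    rw [← Real.rpow_mul hM0.le, one_div_mul_cancel hp0.ne', Real.rpow_one]
  set f := convolution (normInd A) (ind B) with hf
  set c := fourierCoeff f with hc
  set β := (B.card : ℝ) / A.card with hβ
  have hβ0 : 0 < β := by positivity
  set w : AddChar G ℂ → ℂ := fun γ => (‖charAvg T γ‖ : ℂ) ^ (2 * k) * (γ t - 1) with hw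
  have hdiff : ∀ x, (smooth T)^[k] f (x + t) - (smooth T)^[k] f x =
      trigSum (fun γ => c γ * w γ) x := by
    intro x
    rw [← trigSum_fourierCoeff f, iterate_smooth_trigSum]
    simp only [trigSum]
    rw [← Finset.sum_sub_distrib]
    refine Finset.sum_congr rfl fun γ _ => ?_
    rw [AddChar.map_add_eq_mul, hw]
    ring
  have hwη : ∀ γ, ‖w γ‖ ≤ ε / Real.sqrt K := fun γ => by
    refine le_trans (le_of_eq ?_) (h γ)
    simp [hw]
  simp only [hdiff]
  rw [normLp_le_iff (by linarith) _ (by positivity), Real.mul_rpow hε.le (by positivity), hMp]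
  refine (expect_norm_trigSum_rpow_le hp c w hwη).trans ?_
  have hrpow : ∀ y : ℝ, 0 < y → y ^ (p - 2) * y ^ 2 = y ^ p := fun y hy => by
    rw [← Real.rpow_two, ← Real.rpow_add hy, sub_add_cancel]
  calc (ε / Real.sqrt K * ∑ γ, ‖c γ‖) ^ (p - 2) * ((ε / Real.sqrt K) ^ 2 * ∑ γ, ‖c γ‖ ^ 2)
      ≤ (ε / Real.sqrt K * Real.sqrt β) ^ (p - 2) *
          ((ε / Real.sqrt K) ^ 2 * (β * B.dens)) := by
        gcongr
        · exact sum_norm_fourierCoeff_convolution_le A B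
        · exact sum_norm_fourierCoeff_convolution_sq_le hA B
    _ = (ε * Real.sqrt (β / K)) ^ (p - 2) * (ε * Real.sqrt (β / K)) ^ 2 * B.dens := by
        rw [Real.sqrt_div hβ0.le, ← mul_div_assoc, mul_div_right_comm, mul_pow _ _ 2,
          Real.sq_sqrt hβ0.le]
        ring
    _ = ε ^ p * ((β / K) ^ (p / 2) * B.dens) := by
        rw [hrpow _ (by positivity), Real.mul_rpow hε.le (by positivity), Real.sqrt_eq_rpow,
          ← Real.rpow_mul (by positivity)]
        rw [show 1 / 2 * p = p / 2 by ring]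
        ring
    _ ≤ ε ^ p * M := by
        gcongr
        refine le_trans ?_ (dens_mul_rpow_le_expect_proportion_rpow hA hB
          (show 1 ≤ p / 2 by linarith))
        rw [mul_comm]
        gcongr
        -- Here |A + B| ≤ K|A| enters. The exponent p/2 exceeds the p/2 - 1 needed, and the spare
        -- factor is at most 1.
        have hr : β / K ≤ (B.card : ℝ) / (A + B).card := by
          rw [hβ, div_div, mul_comm]
          gcongr
        have hr1 : (B.card : ℝ) / (A + B).card ≤ 1 := by
          refine div_le_one_of_le₀ ?_ hAB0.le
          exact_mod_cast Finset.card_le_card_add_left hA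
        calc (β / K) ^ (p / 2) ≤ ((B.card : ℝ) / (A + B).card) ^ (p / 2) := by gcongr
          _ ≤ ((B.card : ℝ) / (A + B).card) ^ (p / 2 - 1) :=
            Real.rpow_le_rpow_of_exponent_ge (by positivity) hr1 (by linarith)

end Spectrum

/-! ### Spectral decay and the density of T -/

section Assembly

variable {G : Type*} [AddCommGroup G] [Fintype G]

/-- On the large spectrum the power is at most 1 and `h` applies. Elsewhere it is at most 4^(-k),
and 4^k ≥ exp(k) ≥ (2K/ε)² beats the target. -/
lemma charAvg_pow_mul_norm_sub_one_le {T : Finset G} {K ε : ℝ} (hK : 1 ≤ K) (hε : 0 < ε)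
    (hε1 : ε ≤ 1) {k : ℕ} (hk : 2 * Real.log (2 * K / ε) ≤ k) {γ : AddChar G ℂ} {t : G}
    (h : 1 / 2 ≤ ‖charAvg T γ‖ → ‖γ t - 1‖ ≤ ε / 2 / Real.sqrt K) :
    ‖charAvg T γ‖ ^ (2 * k) * ‖γ t - 1‖ ≤ ε / 2 / Real.sqrt K := by
  rcases le_total (1 / 2) ‖charAvg T γ‖ with hγ | hγ
  · calc ‖charAvg T γ‖ ^ (2 * k) * ‖γ t - 1‖ ≤ 1 * ‖γ t - 1‖ := by
          gcongr
          exact pow_le_one₀ (norm_nonneg _) (norm_charAvg_le_one T γ)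
      _ ≤ ε / 2 / Real.sqrt K := by rw [one_mul]; exact h hγ
  · have hs1 : 1 ≤ Real.sqrt K := Real.one_le_sqrt.2 hK
    have hsK : Real.sqrt K ≤ K := by
      nlinarith [Real.sq_sqrt (show 0 ≤ K by linarith)]
    have h1 : ‖γ t - 1‖ ≤ 2 := by
      refine (norm_sub_le _ _).trans ?_
      rw [norm_apply_eq_one, norm_one]; norm_num
    have h2 : 4 * Real.sqrt K / ε ≤ 4 ^ k := by
      have h3 : Real.exp (2 * Real.log (2 * K / ε)) = (2 * K / ε) ^ 2 := by
        rw [mul_comm, Real.exp_mul, Real.exp_log (by positivity), Real.rpow_two]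
      have h4 : Real.exp k ≤ 4 ^ k := by
        rw [← mul_one (k : ℝ), Real.exp_nat_mul]
        gcongr
        linarith [Real.exp_one_lt_d9]
      refine le_trans ?_ ((Real.exp_le_exp.2 hk).trans h4)
      rw [h3, div_pow, div_le_div_iff₀ hε (by positivity)]
      have h5 : ε ^ 2 ≤ ε := by nlinarith
      calc 4 * Real.sqrt K * ε ^ 2 ≤ 4 * K * ε := by gcongr
        _ ≤ (2 * K) ^ 2 * ε := by gcongr; nlinarith
    have hs0 : 0 < Real.sqrt K := by linarith
    calc ‖charAvg T γ‖ ^ (2 * k) * ‖γ t - 1‖ ≤ (1 / 2) ^ (2 * k) * 2 := by gcongr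
      _ = 2 / 4 ^ k := by
        rw [pow_mul, div_pow, div_pow]; norm_num
        ring
      _ ≤ 2 / (4 * Real.sqrt K / ε) := by gcongr
      _ = ε / 2 / Real.sqrt K := by field_simp; norm_num

lemma log_inv_dens_le {B T : Finset G} (hB : B.Nonempty) (hT : T.Nonempty) {K : ℝ} (hK : 1 ≤ K)
    {n : ℕ} (hn : 1 ≤ n) (h : (B.card : ℝ) ≤ 2 * K ^ n * T.card) :
    Real.log ((T.dens : ℝ)⁻¹) ≤ Real.log ((B.dens : ℝ)⁻¹) + n * Real.log (2 * K) := by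
  have hB0 : (0 : ℝ) < B.card := by exact_mod_cast hB.card_pos
  have hT0 : (0 : ℝ) < T.card := by exact_mod_cast hT.card_pos
  have hG0 : (0 : ℝ) < Fintype.card G := by exact_mod_cast Fintype.card_pos_iff.2 ⟨0⟩
  have hBd : (0 : ℝ) < B.dens := by exact_mod_cast hB.dens_pos
  rw [← Real.log_pow, ← Real.log_mul (by positivity) (by positivity)]
  refine Real.log_le_log (by have : (0 : ℝ) < T.dens := by exact_mod_cast hT.dens_pos
                             positivity) ?_
  rw [Finset.dens, Finset.dens]
  push_cast
  rw [inv_div, inv_div, div_mul_eq_mul_div, div_le_div_iff₀ hT0 hB0]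
  -- Uses n ≥ 1, to merge the factor 2 into the power.
  have h2 : 2 * K ^ n ≤ (2 * K) ^ n := by
    rw [mul_pow]
    gcongr
    exact le_self_pow₀ (by norm_num) (by omega)
  calc (Fintype.card G : ℝ) * B.card ≤ Fintype.card G * ((2 * K) ^ n * T.card) := by
        gcongr
        exact h.trans (by gcongr)
    _ = _ := by ring

end Assembly

/-! ### Numerical bounds for the parameters -/

section Parameters

/-- The number of smoothing steps. -/
noncomputable def steps (K ε : ℝ) : ℕ := ⌈2 * Real.log (2 * K / ε)⌉₊

/-- The accuracy with which single translates are controlled. -/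
noncomputable def accuracy (K ε : ℝ) : ℝ := ε / (960 * steps K ε)

variable {K ε p : ℝ}

lemma half_le_log_two_mul_div (hK : 1 ≤ K) (hε : 0 < ε) (hε1 : ε ≤ 1) :
    1 / 2 ≤ Real.log (2 * K / ε) := by
  have h : Real.log 2 ≤ Real.log (2 * K / ε) := by
    refine Real.log_le_log (by norm_num) ?_
    rw [le_div_iff₀ hε]
    nlinarith
  linarith [Real.log_two_gt_d9]

lemma steps_pos (hK : 1 ≤ K) (hε : 0 < ε) (hε1 : ε ≤ 1) : 0 < steps K ε :=
  Nat.ceil_pos.2 (by linarith [half_le_log_two_mul_div hK hε hε1])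

lemma steps_le (hK : 1 ≤ K) (hε : 0 < ε) (hε1 : ε ≤ 1) :
    (steps K ε : ℝ) ≤ 4 * Real.log (2 * K / ε) := by
  have h := half_le_log_two_mul_div hK hε hε1
  have := Nat.ceil_lt_add_one (show 0 ≤ 2 * Real.log (2 * K / ε) by linarith)
  rw [steps]
  linarith

lemma accuracy_pos (hK : 1 ≤ K) (hε : 0 < ε) (hε1 : ε ≤ 1) : 0 < accuracy K ε := by
  have : (0 : ℝ) < steps K ε := by exact_mod_cast steps_pos hK hε hε1
  rw [accuracy]; positivity

lemma accuracy_le (hK : 1 ≤ K) (hε : 0 < ε) (hε1 : ε ≤ 1) : accuracy K ε ≤ ε := by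
  have : (1 : ℝ) ≤ steps K ε := by exact_mod_cast steps_pos hK hε hε1
  exact div_le_self hε.le (by linarith)

lemma div_accuracy_sq_le (hK : 1 ≤ K) (hε : 0 < ε) (hε1 : ε ≤ 1) (hp : 0 ≤ p) :
    2 * (p / accuracy K ε ^ 2) ≤ 29491200 * (p * Real.log (2 * K / ε) ^ 2 / ε ^ 2) := by
  have h := steps_le hK hε hε1
  have h2 : 2 * (p / accuracy K ε ^ 2) = 1843200 * (p * (steps K ε : ℝ) ^ 2 / ε ^ 2) := by
    rw [accuracy]
    field_simp
    ring
  rw [h2]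
  calc 1843200 * (p * (steps K ε : ℝ) ^ 2 / ε ^ 2)
      ≤ 1843200 * (p * (4 * Real.log (2 * K / ε)) ^ 2 / ε ^ 2) := by gcongr
    _ = _ := by ring

/-- Serves to absorb the + 1 in Chang's bound into the main term. -/
lemma one_le_four_mul_bound (hK : 1 ≤ K) (hε : 0 < ε) (hε1 : ε ≤ 1) (hp : 2 ≤ p) :
    1 ≤ 4 * (p * Real.log (2 * K / ε) ^ 2 * Real.log (2 * K) / ε ^ 2) := by
  have h1 := half_le_log_two_mul_div hK hε hε1
  have h2 : 1 / 2 ≤ Real.log (2 * K) := by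
    simpa using half_le_log_two_mul_div hK one_pos le_rfl
  have h3 : ε ^ 2 ≤ 1 := pow_le_one₀ hε.le hε1
  calc (1 : ℝ) = 4 * (2 * (1 / 2) ^ 2 * (1 / 2) / 1) := by norm_num
    _ ≤ 4 * (p * Real.log (2 * K / ε) ^ 2 * Real.log (2 * K) / ε ^ 2) := by gcongr

end Parameters

end AlmostPeriodicity

/-! ### The main theorem -/

theorem theorem5p2 :
    ∃ c C : ℝ, 0 < c ∧ 0 < C ∧
      ∀ (G : Type*) [AddCommGroup G] [Fintype G] [DecidableEq G]
        (A B : Finset G) (K_A K_B p ε : ℝ),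
        A.Nonempty → B.Nonempty →
        ((A + B).card : ℝ) ≤ K_A * (A.card : ℝ) →
        ((A + B).card : ℝ) ≤ K_B * (B.card : ℝ) →
        2 ≤ p → 0 < ε → ε ≤ 1 / Real.sqrt K_B →
        ∃ (Γ : Finset (AddChar G ℂ)) (δ : ℝ),
          Γ.Nonempty ∧
          (Γ.card : ℝ) ≤
            C * p * Real.log (2 * K_A / ε) ^ 2 * Real.log (2 * K_A) / ε ^ 2
              + C * Real.log ((B.dens : ℝ)⁻¹) ∧
          c * ε / ((Γ.card : ℝ) * Real.sqrt K_A) ≤ δ ∧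
          ∀ t ∈ AlmostPeriodicity.bohrSet Γ δ,
            AlmostPeriodicity.normLp p (fun x =>
              AlmostPeriodicity.convolution
                  (AlmostPeriodicity.normInd A) (AlmostPeriodicity.ind B) (x + t)
                - AlmostPeriodicity.convolution
                  (AlmostPeriodicity.normInd A) (AlmostPeriodicity.ind B) x)
              ≤ ε * AlmostPeriodicity.normLp (p / 2)
                  (AlmostPeriodicity.convolution
                    (AlmostPeriodicity.normInd A) (AlmostPeriodicity.ind B)) ^ ((1 : ℝ) / 2) := by
  -- The first constant reflects the accuracy ε/2 required of the smoothed function. The second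
  -- exceeds 8 · 29491200 + 4, from Chang's factor 8, the bound on n and the absorbed + 1.
  refine ⟨1 / 2, 240000000, by norm_num, by norm_num, ?_⟩
  intro G _ _ _ A B K_A K_B p ε hA hB hKA hKB hp hε hεK
  have hA0 : (0 : ℝ) < A.card := by exact_mod_cast hA.card_pos
  have hB0 : (0 : ℝ) < B.card := by exact_mod_cast hB.card_pos
  have hAB0 : (0 : ℝ) < (A + B).card := by exact_mod_cast (hA.add hB).card_pos
  have hKA1 : 1 ≤ K_A := by
    have h : (A.card : ℝ) ≤ (A + B).card := by exact_mod_cast Finset.card_le_card_add_right hB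
    exact le_of_mul_le_mul_right (by linarith) hA0
  have hKB1 : 1 ≤ K_B := by
    have h : (B.card : ℝ) ≤ (A + B).card := by exact_mod_cast Finset.card_le_card_add_left hA
    exact le_of_mul_le_mul_right (by linarith) hB0
  have hsB : 1 ≤ Real.sqrt K_B := Real.one_le_sqrt.2 hKB1
  have hε1 : ε ≤ 1 := hεK.trans (div_le_one_of_le₀ hsB (by linarith))
  set k := AlmostPeriodicity.steps K_A ε with hk
  set θ := AlmostPeriodicity.accuracy K_A ε with hθ
  have hk0 : (0 : ℝ) < k := by exact_mod_cast AlmostPeriodicity.steps_pos hKA1 hε hε1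
  have hθ0 : 0 < θ := AlmostPeriodicity.accuracy_pos hKA1 hε hε1
  have hθε : θ ≤ ε := AlmostPeriodicity.accuracy_le hKA1 hε hε1
  have hθB : θ ^ 2 ≤ (B.card : ℝ) / (A + B).card := by
    calc θ ^ 2 ≤ (1 / Real.sqrt K_B) ^ 2 := by gcongr; exact hθε.trans hεK
      _ = 1 / K_B := by rw [div_pow, Real.sq_sqrt (by linarith), one_pow]
      _ ≤ (B.card : ℝ) / (A + B).card := by
        rw [div_le_div_iff₀ (by linarith) hAB0]; linarith
  have hpθ : 1 ≤ p / θ ^ 2 := by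
    rw [le_div_iff₀ (by positivity)]
    have : θ ^ 2 ≤ 1 := pow_le_one₀ hθ0.le (hθε.trans hε1)
    linarith
  -- Rounding up at most doubles p/θ², since p/θ² ≥ 1.
  obtain ⟨n, hn, hn'⟩ : ∃ n : ℕ, p / θ ^ 2 ≤ n ∧ (n : ℝ) ≤ 2 * (p / θ ^ 2) :=
    ⟨⌈p / θ ^ 2⌉₊, Nat.le_ceil _, by
      linarith [Nat.ceil_lt_add_one (show 0 ≤ p / θ ^ 2 by linarith)]⟩
  have hn1 : 1 ≤ n := by exact_mod_cast hpθ.trans hn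
  obtain ⟨T, hT, hTcard, hTper⟩ :=
    AlmostPeriodicity.exists_subset_forall_normLp_translate_sub_le hA hB hKA hp hθ0 hθB hn hn'
  obtain ⟨Γ, hΓ, hΓcard, hΓspec⟩ :=
    AlmostPeriodicity.exists_forall_mem_bohrSet_norm_sub_one_le hT
  have hΓ0 : (0 : ℝ) < Γ.card := by exact_mod_cast hΓ.card_pos
  have hsA : 0 < Real.sqrt K_A := Real.sqrt_pos.2 (by linarith)
  -- The radius for which |Γ| δ = ε/(2√K_A), the accuracy needed on the large spectrum.
  refine ⟨Γ, 1 / 2 * ε / (Γ.card * Real.sqrt K_A), hΓ, ?_, le_rfl, fun t ht => ?_⟩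
  · have h1 := AlmostPeriodicity.log_inv_dens_le hB hT hKA1 hn1 hTcard
    have h2 := AlmostPeriodicity.div_accuracy_sq_le (p := p) hKA1 hε hε1 (by linarith)
    have h3 := AlmostPeriodicity.one_le_four_mul_bound hKA1 hε hε1 hp
    have hlog : 0 ≤ Real.log (2 * K_A) := Real.log_nonneg (by linarith)
    have hlogB : 0 ≤ Real.log ((B.dens : ℝ)⁻¹) := by
      refine Real.log_nonneg ((one_le_inv₀ ?_).2 ?_)
      · exact_mod_cast hB.dens_pos
      · exact_mod_cast Finset.dens_le_one
    have h4 := mul_le_mul_of_nonneg_right (hn'.trans h2) hlog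
    set X := p * Real.log (2 * K_A / ε) ^ 2 * Real.log (2 * K_A) / ε ^ 2 with hX
    have h5 : 29491200 * (p * Real.log (2 * K_A / ε) ^ 2 / ε ^ 2) * Real.log (2 * K_A) =
        29491200 * X := by rw [hX]; ring
    have h6 : 240000000 * p * Real.log (2 * K_A / ε) ^ 2 * Real.log (2 * K_A) / ε ^ 2 =
        240000000 * X := by rw [hX]; ring
    rw [h5] at h4
    rw [h6]
    linarith
  · set f := AlmostPeriodicity.convolution (AlmostPeriodicity.normInd A)
      (AlmostPeriodicity.ind B) with hf
    set N := AlmostPeriodicity.normLp (p / 2) f ^ ((1 : ℝ) / 2) with hN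
    have hN0 : 0 ≤ N := Real.rpow_nonneg (AlmostPeriodicity.normLp_nonneg _ _) _
    have hp1 : 1 ≤ p := by linarith
    have hsmooth := AlmostPeriodicity.normLp_iterate_smooth_sub_le hp1 hT f
      (by positivity) hTper k
    -- The 960 in `accuracy` is 4 · 240, leaving ε/4 for each of the two comparisons of f with g.
    have hkθ : k * (240 * θ * N) = ε / 4 * N := by
      rw [hθ, AlmostPeriodicity.accuracy, ← hk]
      field_simp
      ring
    rw [hkθ] at hsmooth
    have hmid := AlmostPeriodicity.normLp_translate_iterate_smooth_sub_le hA hB hp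
      (half_pos hε) hKA T k t fun γ =>
        AlmostPeriodicity.charAvg_pow_mul_norm_sub_one_le hKA1 hε hε1 (Nat.le_ceil _) fun hγ => by
          refine (hΓspec _ t ht γ hγ).trans (le_of_eq ?_)
          field_simp
    set g := (AlmostPeriodicity.smooth T)^[k] f with hg
    have htrans : AlmostPeriodicity.normLp p (fun x => f (x + t) - g (x + t)) ≤ ε / 4 * N := by
      rw [AlmostPeriodicity.normLp_translate p (fun x => f x - g x) t,
        AlmostPeriodicity.normLp_sub_comm]
      exact hsmooth
    have h1 := AlmostPeriodicity.normLp_sub_le hp1 (fun x => f (x + t)) (fun x => g (x + t)) f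
    have h2 := AlmostPeriodicity.normLp_sub_le hp1 (fun x => g (x + t)) g f
    -- ε/4 + ε/2 + ε/4 = ε, along f(· + t), g(· + t), g, f.
    linarith
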